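/- Let $n\ge 1$, $\alpha\in(\mathbb R\setminus\{0\})^n$, $C\in\mathbb R$, and let $$D=D_{\alpha,C}:=\{z\in\mathbb C^n:\ |z_1|^{\alpha_1}\cdots|z_n|^{\alpha_n}<e^C,\ \ z_j\ne 0 \text{ whenever } \alpha_j<0\}$$ be the elementary Reinhardt domain (in particular $D_\alpha:=D_{\alpha,0}$). Let $\Delta$ be the open unit disc in $\mathbb C$, $\mathcal O(D,G)$ the set of holomorphic maps $D\to G$, and $\|\cdot\|$ the Euclidean norm. For $a\in D$, $X\in\mathbb C^n$, $k\ge 1$ put $$\gamma_D^{(k)}(a;X):=\sup\Big\{\Big|\tfrac1{k!}f^{(k)}(a)X\Big|^{1/k}: f\in\mathcal O(D,\Delta),\ \operatorname{ord}_a f\ge k\Big\},$$ where $f^{(k)}(a)X$ is the $k$-th derivative of $f$ at $a$ evaluated at $(X,\dots,X)$, $$A_D(a;X):=\sup\Big\{\limsup_{0\ne\lambda\to0}\frac{v(a+\lambda X)}{|\lambda|}: v:D\to[0,1),\ \log v \text{ plurisubharmonic},\ \exists M,r>0:\ v(z)\le M\|z-a\| \text{ if } z\in D,\ \|z-a\|<r\Big\},$$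 $$\kappa_D(a;X):=\inf\{t>0:\ \exists\varphi\in\mathcal O(\Delta,D):\ \varphi(0)=a,\ t\varphi'(0)=X\}.$$ A pseudometric on $D$ is a function $\eta:D\times\mathbb C^n\to[0,\infty)$ with $\eta(a;\lambda X)=|\lambda|\,\eta(a;X)$ for $\lambda\in\mathbb C$. Let $\mathcal M(D)$ be the set of all pseudometrics $\eta$ on $D$ such that every $a\in D$ has a ball $\mathbb B(a,r)\subset D$ and a constant $M>0$ with $\eta(z;X)\le M\|X\|$ for $z\in\mathbb B(a,r)$, $X\in\mathbb C^n$. For a function $\eta: D\times\mathbb C^n\to[0,\infty)$ let $$\widehat\eta(a;X):=\sup\{p(X): p \text{ a complex seminorm on } \mathbb C^n,\ p\le\eta(a;\cdot)\}$$ (the Busemann pseudometric), let $U_\eta(a)$ be the orthogonal complement of $\{X:\widehat\eta(a;X)=0\}$ and $m(\eta,a):=\dim U_\eta(a)$. For a positive semidefinite Hermitian form $s$ put $q_s(X):=\sqrt{s(X,X)}$, and let $\mathcal F(\eta,a)$ be the set of those $s$ with $q_s\le\eta(a;\cdot)$. Let $s(\eta,a)$ be the element of $\mathcal F(\eta,a)$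 that is maximal for the relation $s\prec t:\iff\det[s(e_j,e_k)]_{j,k}\le\det[t(e_j,e_k)]_{j,k}$ for any basis $(e_j)$ of $U_\eta(a)$, and define $$\widetilde{\mathbb W}\eta(a;X):=q_{s(\eta,a)}(X),\qquad \mathbb W\eta(a;X):=\sqrt{m(\eta,a)}\;\widetilde{\mathbb W}\eta(a;X).$$ Then: (1) For every $\eta\in\mathcal M(D)$ with $\eta\le\kappa_D$ and every $a\in D$, the maximal element $s(\eta,a)$ exists and is unique, and for all $X\in\mathbb C^n$ $$\mathbb W\eta(a;X)=\widetilde{\mathbb W}\eta(a;X)=\widehat\eta(a;X).$$ (2) If $\eta$ is one of $\gamma_D^{(k)}$ ($k\ge1$), $A_D$, $\kappa_D$, then for all $a\in D$ and $X\in\mathbb C^n$, with $s$ the number of nonzero coordinates of $a$, $$\widehat\eta(a;X)=\begin{cases}\eta(a;X)&\text{if } s\ge n-1,\\ 0&\text{if } s<n-1.\end{cases}$$ -/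

import Mathlib

open scoped ComplexOrder

noncomputable section

namespace WuMetric

/-- `ℂⁿ` with its standard Hermitian structure. -/
abbrev Cn (n : ℕ) : Type := EuclideanSpace ℂ (Fin n)

/-! ### Subharmonic and plurisubharmonic functions -/

/-- Mean value of `u` over the circle `|ζ - c| = r`, relative to a real upper bound `M` of `u` on
that circle: `M - (1/2π) ∫₀^{2π} (M - u(c + r e^{iθ})) dθ`. The integrand is nonnegative, so that
the mean value is a well-defined element of `[-∞, M]`; it does not depend on `M`. -/
def circleMean (u : ℂ → EReal) (c : ℂ) (r : ℝ) (M : ℝ) : EReal :=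
  (M : EReal) - ((MeasureTheory.laverage
    (MeasureTheory.volume.restrict (Set.Ioc 0 (2 * Real.pi)))
    (fun θ : ℝ => ((M : EReal) - u (circleMap c r θ)).toENNReal) : ENNReal) : EReal)

/-- Subharmonic functions `u : U → [-∞, ∞)` on an open subset `U` of the plane: upper semicontinuous
functions with the sub-mean value property (`u ≡ -∞` is allowed). -/
def IsSubharmonicOn (u : ℂ → EReal) (U : Set ℂ) : Prop :=
  UpperSemicontinuousOn u U ∧ (∀ z ∈ U, u z < ⊤) ∧
  ∀ (c : ℂ) (r : ℝ), 0 < r → Metric.closedBall c r ⊆ U →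
    ∀ M : ℝ, (∀ z ∈ Metric.sphere c r, u z ≤ (M : EReal)) → u c ≤ circleMean u c r M

/-- Plurisubharmonic functions `u : D → [-∞, ∞)` on an open subset `D` of `ℂⁿ`: upper semicontinuous
functions whose composition with every holomorphic curve in `D` is subharmonic. This is the
coordinate-free definition, used on complex manifolds and spaces; for open subsets of `ℂⁿ` it gives
the same class of functions as testing on complex lines only. -/
def IsPSHOn {n : ℕ} (u : Cn n → EReal) (D : Set (Cn n)) : Prop :=
  UpperSemicontinuousOn u D ∧ (∀ z ∈ D, u z < ⊤) ∧
  ∀ (U : Set ℂ) (φ : ℂ → Cn n), IsOpen U → DifferentiableOn ℂ φ U → Set.MapsTo φ U D →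
    IsSubharmonicOn (fun ζ => u (φ ζ)) U

/-- `v ≥ 0` is log-plurisubharmonic on `D`: `log v` is plurisubharmonic, where `log 0 = -∞`. -/
def IsLogPSHOn {n : ℕ} (v : Cn n → ℝ) (D : Set (Cn n)) : Prop :=
  IsPSHOn (fun z => ENNReal.log (ENNReal.ofReal (v z))) D

/-! ### The Carathéodory–Reiffen, Azukawa and Kobayashi–Royden pseudometrics

For an open set `D` and `a ∈ D` the suprema and infima below are taken over nonempty sets of reals
that are bounded above (respectively below). -/

/-- The Carathéodory–Reiffen pseudometric of order `k`: the supremum of `|f⁽ᵏ⁾(a)X / k!|^{1/k}` over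
holomorphic `f : D → Δ` that vanish at `a` to order at least `k`. -/
def caratheodoryReiffen {n : ℕ} (k : ℕ) (D : Set (Cn n)) (a X : Cn n) : ℝ :=
  sSup {t : ℝ | ∃ f : Cn n → ℂ, DifferentiableOn ℂ f D ∧ Set.MapsTo f D (Metric.ball 0 1) ∧
    (∀ j < k, iteratedFDeriv ℂ j f a = 0) ∧
    t = ‖(1 / (k.factorial : ℂ)) * iteratedFDeriv ℂ k f a (fun _ => X)‖ ^ (1 / (k : ℝ))}

/-- The Azukawa pseudometric. -/
def azukawa {n : ℕ} (D : Set (Cn n)) (a X : Cn n) : ℝ :=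
  sSup {t : ℝ | ∃ v : Cn n → ℝ, (∀ z ∈ D, 0 ≤ v z ∧ v z < 1) ∧ IsLogPSHOn v D ∧
    (∃ M > (0 : ℝ), ∃ r > (0 : ℝ), ∀ z ∈ D, ‖z - a‖ < r → v z ≤ M * ‖z - a‖) ∧
    t = Filter.limsup (fun l : ℂ => v (a + l • X) / ‖l‖) (nhdsWithin 0 {0}ᶜ)}

/-- The Kobayashi–Royden pseudometric. -/
def kobayashiRoyden {n : ℕ} (D : Set (Cn n)) (a X : Cn n) : ℝ :=
  sInf {t : ℝ | 0 < t ∧ ∃ φ : ℂ → Cn n, DifferentiableOn ℂ φ (Metric.ball 0 1) ∧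
    Set.MapsTo φ (Metric.ball 0 1) D ∧ φ 0 = a ∧ (t : ℂ) • deriv φ 0 = X}

/-! ### Pseudometrics, the Busemann pseudometric, the Wu pseudometrics -/

/-- `η` (restricted to `D × ℂⁿ`) is a pseudometric on `D`. -/
def IsPseudometricOn {n : ℕ} (D : Set (Cn n)) (η : Cn n → Cn n → ℝ) : Prop :=
  ∀ a ∈ D, ∀ X : Cn n, 0 ≤ η a X ∧ ∀ l : ℂ, η a (l • X) = ‖l‖ * η a X

/-- The class `𝓜(D)` of pseudometrics on `D` that are locally bounded by multiples of the
Euclidean norm. -/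
def ClassM {n : ℕ} (D : Set (Cn n)) (η : Cn n → Cn n → ℝ) : Prop :=
  IsPseudometricOn D η ∧
  ∀ a ∈ D, ∃ M > (0 : ℝ), ∃ r > (0 : ℝ), Metric.ball a r ⊆ D ∧
    ∀ z ∈ Metric.ball a r, ∀ X : Cn n, η z X ≤ M * ‖X‖

/-- The Busemann pseudometric `η̂(a; X)`: the supremum of `p X` over all complex seminorms
`p ≤ η(a; ·)`. -/
def busemann {n : ℕ} (η : Cn n → Cn n → ℝ) (a X : Cn n) : ℝ :=
  sSup {t : ℝ | ∃ p : Seminorm ℂ (Cn n), (∀ Y, p Y ≤ η a Y) ∧ t = p X}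

/-- `U_η(a)`: the orthogonal complement of `V_η(a) = {X | η̂(a; X) = 0}`. -/
def wuU {n : ℕ} (η : Cn n → Cn n → ℝ) (a : Cn n) : Submodule ℂ (Cn n) :=
  (Submodule.span ℂ {X : Cn n | busemann η a X = 0})ᗮ

/-- `m(η, a) = dim U_η(a)`. -/
def wuDim {n : ℕ} (η : Cn n → Cn n → ℝ) (a : Cn n) : ℕ :=
  Module.finrank ℂ (wuU η a)

/-- Sesquilinear forms on `ℂⁿ` (conjugate-linear in the first variable). -/
abbrev SesqForm (n : ℕ) : Type := Cn n →ₗ⋆[ℂ] Cn n →ₗ[ℂ] ℂ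

/-- `q_s(X) = √ s(X, X)`. -/
def qForm {n : ℕ} (s : SesqForm n) (X : Cn n) : ℝ :=
  Real.sqrt (s X X).re

/-- `𝓕(η, a)`: the pseudo-Hermitian (i.e. Hermitian and positive semidefinite) scalar products `s`
with `q_s ≤ η(a; ·)`. -/
def wuF {n : ℕ} (η : Cn n → Cn n → ℝ) (a : Cn n) : Set (SesqForm n) :=
  {s | s.IsPosSemidef ∧ ∀ X, qForm s X ≤ η a X}

/-- The relation `s ≺ t`: the Gram determinant of `s` is at most that of `t`, for any basis of
`U_η(a)`. (The determinants are real; a change of basis multiplies both by the same positive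
number, so that `≺` is total.) -/
def wuLE {n : ℕ} (η : Cn n → Cn n → ℝ) (a : Cn n) (s t : SesqForm n) : Prop :=
  ∀ e : Module.Basis (Fin (wuDim η a)) ℂ (wuU η a),
    (Matrix.of fun j k => s (e j : Cn n) (e k : Cn n)).det.re ≤
      (Matrix.of fun j k => t (e j : Cn n) (e k : Cn n)).det.re

/-- `s` is a maximal element of `𝓕(η, a)` for `≺`. -/
def IsWuForm {n : ℕ} (η : Cn n → Cn n → ℝ) (a : Cn n) (s : SesqForm n) : Prop :=
  s ∈ wuF η a ∧ ∀ t ∈ wuF η a, wuLE η a t s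

/-- `s(η, a)`: the maximal element of `𝓕(η, a)`. -/
def wuForm {n : ℕ} (η : Cn n → Cn n → ℝ) (a : Cn n) : SesqForm n :=
  Classical.epsilon (IsWuForm η a)

/-- `𝕎̃η(a; X)`, the Wu pseudometric before normalization. -/
def wuTilde {n : ℕ} (η : Cn n → Cn n → ℝ) (a X : Cn n) : ℝ :=
  qForm (wuForm η a) X

/-- The Wu pseudometric `𝕎η(a; X)`. -/
def wu {n : ℕ} (η : Cn n → Cn n → ℝ) (a X : Cn n) : ℝ :=
  Real.sqrt (wuDim η a) * wuTilde η a X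

/-! ### Elementary Reinhardt domains -/

/-- `D_{α,C} = {z : |z₁|^{α₁} ⋯ |zₙ|^{αₙ} < e^C, and z_j ≠ 0 whenever α_j < 0}`. -/
def elemReinhardt {n : ℕ} (α : Fin n → ℝ) (C : ℝ) : Set (Cn n) :=
  {z | (∀ j, α j < 0 → z j ≠ 0) ∧ ∏ j, ‖z j‖ ^ α j < Real.exp C}

/-- The number of nonzero coordinates of `a`. -/
def numNonzero {n : ℕ} (a : Cn n) : ℕ :=
  (Finset.univ.filter fun j : Fin n => a j ≠ 0).card

end WuMetric

end

open scoped ComplexOrder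

noncomputable section

namespace WuMetric

/-! ### Liouville's theorem for subharmonic functions -/

section
open Metric MeasureTheory Filter Topology Set

/-! The domain is filled with entire curves. If `∑ α_j c_j = 0`, then `μ ↦ (z_j exp(μ c_j))`
preserves `∏ |z_j|^α_j`, so it stays in `D`. Bounded holomorphic functions are constant on such
curves by Liouville, and functions `v < 1` with `log v` plurisubharmonic are so by Liouville for
subharmonic functions (`IsSubharmonicOn.eq_of_nonpos`).

If at most one coordinate of `a`, say the `i`-th, vanishes, these curves sweep out near `a` the
leaves of a codimension-one foliation transversal to the axis `a + ℂ e_i`. Every competitor for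
`γ^(k)` or `A` is then a function of the single coordinate `leafCoord`, so the metric at `a` is a
constant times the modulus of its derivative `leafForm`. For `κ` the same follows by multiplying
analytic discs by `exp(μ c_j)`, which changes their velocity by any vector of `ker leafForm`
(`kobayashiRoyden_congr_leafForm`).

If at least two coordinates vanish, moving along any axis keeps another coordinate zero, hence stays
in `D` as long as no coordinate with negative exponent becomes zero. All the metrics therefore
vanish on the standard basis, and a seminorm below them is zero.

So for every `η ≤ κ` the Busemann pseudometric is `|L|` for a linear form `L`, possibly zero. The
form `conj(L X) * L Y` is then the unique maximal one, and since `m ∈ {0, 1}` the factor `√m`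
changes nothing (`existsUnique_isWuForm_of_busemann_eq`). -/

theorem ofReal_le_toENNReal_sub {M x : ℝ} {y : EReal} (h : y ≤ x) :
    ENNReal.ofReal (M - x) ≤ ((M : EReal) - y).toENNReal := by
  have := EReal.toENNReal_le_toENNReal (EReal.sub_le_sub (le_refl (M : EReal)) h)
  rwa [← EReal.coe_sub, EReal.toENNReal_of_ne_top (EReal.coe_ne_top _), EReal.toReal_coe] at this

/-- Equality case of the sub-mean value property against a function with the mean value property. -/
theorem le_of_le_circleMean_of_circleAverage_eq {u : ℂ → EReal} {h : ℂ → ℝ} {c : ℂ} {r : ℝ}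
    (hr : 0 < r) (hu : UpperSemicontinuousOn u (sphere c r))
    (hsub : ∀ M : ℝ, (∀ z ∈ sphere c r, u z ≤ (M : EReal)) → u c ≤ circleMean u c r M)
    (hc : ContinuousOn h (sphere c r)) (hm : Real.circleAverage h c r = h c)
    (hle : ∀ z ∈ sphere c r, u z ≤ (h z : EReal)) (heq : (h c : EReal) ≤ u c) :
    ∀ z ∈ sphere c r, (h z : EReal) ≤ u z := by
  intro z₀ hz₀
  by_contra hlt
  rw [not_le] at hlt
  obtain ⟨b, hub, hbh⟩ := EReal.lt_iff_exists_real_btwn.1 hlt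
  have hbh' : b < h z₀ := by exact_mod_cast hbh
  -- By semicontinuity `u < b` and `h > b + δ` persist near `z₀`. There `M - u` exceeds `M - h` by
  -- at least `δ` on a set of angles of positive measure, which makes the mean of `u` strictly
  -- smaller than `h c`.
  set δ := (h z₀ - b) / 2 with hδ
  have hδ0 : 0 < δ := by rw [hδ]; linarith
  have hsph : ∀ θ, circleMap c r θ ∈ sphere c r := fun θ => circleMap_mem_sphere c hr.le θ
  obtain ⟨θ₀, hθ₀, rfl⟩ : ∃ θ ∈ Ioc 0 (2 * Real.pi), circleMap c r θ = z₀ := by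
    have := image_circleMap_Ioc c r
    rw [abs_of_pos hr] at this
    exact (this ▸ hz₀ : z₀ ∈ circleMap c r '' _)
  have htend : Tendsto (circleMap c r) (𝓝 θ₀) (𝓝[sphere c r] circleMap c r θ₀) :=
    tendsto_nhdsWithin_iff.2 ⟨(continuous_circleMap c r).continuousAt, .of_forall hsph⟩
  have hev : ∀ᶠ θ in 𝓝 θ₀, u (circleMap c r θ) < b ∧ b + δ < h (circleMap c r θ) := by
    refine htend.eventually ((hu _ hz₀ _ hub).and ((hc _ hz₀).eventually (lt_mem_nhds ?_)))
    rw [hδ]; linarith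
  obtain ⟨V, hV, hVo, hθV⟩ := _root_.eventually_nhds_iff.1 hev
  obtain ⟨M, hM⟩ := (isCompact_sphere c r).bddAbove_image hc
  have hM' : ∀ z ∈ sphere c r, h z ≤ M := fun z hz => hM ⟨z, hz, rfl⟩
  have hcont : Continuous fun θ => h (circleMap c r θ) :=
    hc.comp_continuous (continuous_circleMap c r) hsph
  have hpt : ∀ θ, ENNReal.ofReal (M - h (circleMap c r θ)) +
      V.indicator (fun _ => ENNReal.ofReal δ) θ ≤ ((M : EReal) - u (circleMap c r θ)).toENNReal := by
    intro θ
    have h0 := sub_nonneg.2 (hM' _ (hsph θ))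
    by_cases hθ : θ ∈ V
    · rw [indicator_of_mem hθ, ← ENNReal.ofReal_add h0 hδ0.le, sub_add]
      refine ofReal_le_toENNReal_sub ((hV θ hθ).1.le.trans ?_)
      have := (hV θ hθ).2
      exact_mod_cast (by linarith : b ≤ h (circleMap c r θ) - δ)
    · rw [indicator_of_notMem hθ, add_zero]
      exact ofReal_le_toENNReal_sub (hle _ (hsph θ))
  have hvol : 0 < volume (V ∩ Ioc 0 (2 * Real.pi)) := by
    -- The angle `θ₀` may be the endpoint `2π`, hence the detour through the closure of the open
    -- interval.
    have hne : (V ∩ Ioo 0 (2 * Real.pi)).Nonempty := by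
      refine mem_closure_iff.1 ?_ V hVo hθV
      rw [closure_Ioo Real.two_pi_pos.ne]
      exact Ioc_subset_Icc_self hθ₀
    exact ((hVo.inter isOpen_Ioo).measure_pos volume hne).trans_le
      (measure_mono (inter_subset_inter_right _ Ioo_subset_Ioc_self))
  have hvol' : volume (V ∩ Ioc 0 (2 * Real.pi)) ≠ ⊤ :=
    ((measure_mono inter_subset_right).trans_lt measure_Ioc_lt_top).ne
  set m := (volume (V ∩ Ioc 0 (2 * Real.pi))).toReal with hmdef
  have hm0 : 0 < m := ENNReal.toReal_pos hvol.ne' hvol'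
  have hint : ∫ θ in Ioc 0 (2 * Real.pi), (M - h (circleMap c r θ)) =
      2 * Real.pi * (M - h c) := by
    rw [Real.circleAverage, smul_eq_mul, inv_mul_eq_iff_eq_mul₀ Real.two_pi_pos.ne'] at hm
    rw [← intervalIntegral.integral_of_le Real.two_pi_pos.le, intervalIntegral.integral_sub
      (by simp) (hcont.intervalIntegrable _ _), hm]
    simp; ring
  have hlint : ENNReal.ofReal (2 * Real.pi * (M - h c) + δ * m) ≤
      ∫⁻ θ in Ioc 0 (2 * Real.pi), ((M : EReal) - u (circleMap c r θ)).toENNReal := by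
    refine le_trans (le_of_eq ?_) (lintegral_mono hpt)
    have hmeas : Measurable fun θ => ENNReal.ofReal (M - h (circleMap c r θ)) :=
      (continuous_const.sub hcont).measurable.ennreal_ofReal
    have hcM : h c ≤ M := by
      have : 0 ≤ 2 * Real.pi * (M - h c) := by
        rw [← hint]
        exact integral_nonneg fun θ => sub_nonneg.2 (hM' _ (hsph θ))
      have := (mul_nonneg_iff_of_pos_left Real.two_pi_pos).1 this
      linarith
    rw [lintegral_add_left hmeas, lintegral_indicator hVo.measurableSet, lintegral_const,
      Measure.restrict_apply_univ, Measure.restrict_apply hVo.measurableSet,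
      ← ofReal_integral_eq_lintegral_ofReal, hint, ENNReal.ofReal_add, ENNReal.ofReal_mul hδ0.le,
      hmdef, ENNReal.ofReal_toReal hvol']
    · have := sub_nonneg.2 hcM
      positivity
    · positivity
    · exact ((continuous_const.sub hcont).integrableOn_Icc).mono_set Ioc_subset_Icc_self
    · exact .of_forall fun θ => sub_nonneg.2 (hM' _ (hsph θ))
  have hlav : ENNReal.ofReal (M - h c + δ * m / (2 * Real.pi)) ≤
      laverage (volume.restrict (Ioc 0 (2 * Real.pi)))
        (fun θ : ℝ => ((M : EReal) - u (circleMap c r θ)).toENNReal) := by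
    rw [laverage_eq, Measure.restrict_apply_univ, Real.volume_Ioc, sub_zero]
    refine le_trans (le_of_eq ?_) (ENNReal.div_le_div_right hlint _)
    rw [← ENNReal.ofReal_div_of_pos Real.two_pi_pos]
    congr 1
    field_simp
  have h1 : u c ≤ circleMean u c r M :=
    hsub M fun z hz => (hle z hz).trans (by exact_mod_cast hM' z hz)
  have h2 : circleMean u c r M ≤ ((M - (M - h c + δ * m / (2 * Real.pi)) : ℝ) : EReal) := by
    rw [circleMean, EReal.coe_sub]
    refine EReal.sub_le_sub le_rfl ?_
    refine le_trans ?_ (EReal.coe_ennreal_le_coe_ennreal_iff.2 hlav)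
    rw [EReal.coe_ennreal_ofReal]
    exact_mod_cast le_max_left _ _
  have h3 := heq.trans (h1.trans h2)
  rw [EReal.coe_le_coe_iff] at h3
  have : 0 < δ * m / (2 * Real.pi) := by positivity
  linarith

theorem circleAverage_const_add_mul_log_norm {q ε r : ℝ} {c : ℂ} (hr : 0 ≤ r)
    (h0 : ∀ z ∈ closedBall c r, z ≠ 0) :
    Real.circleAverage (fun z => q + ε * Real.log ‖z‖) c r = q + ε * Real.log ‖c‖ := by
  have hlog : Real.circleAverage (fun z => Real.log ‖z‖) c r = Real.log ‖c‖ :=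
    AnalyticOnNhd.circleAverage_log_norm_of_ne_zero (g := id) (fun _ _ => analyticAt_id)
      (by rwa [abs_of_nonneg hr])
  have hint : CircleIntegrable (fun z : ℂ => ε * Real.log ‖z‖) c r := by
    refine ContinuousOn.circleIntegrable hr fun z hz => ContinuousAt.continuousWithinAt ?_
    have := norm_ne_zero_iff.2 (h0 z (sphere_subset_closedBall hz))
    fun_prop (disch := assumption)
  rw [Real.circleAverage_fun_add (circleIntegrable_const q c r) hint, Real.circleAverage_const]
  have := Real.circleAverage_fun_smul (a := ε) (f := fun z : ℂ => Real.log ‖z‖) (c := c) (R := r)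
  simp only [smul_eq_mul] at this
  rw [this, hlog]

theorem EReal_sub_coe_le_iff {x : EReal} {a b : ℝ} :
    x - (a : EReal) ≤ b ↔ x ≤ ((b + a : ℝ) : EReal) := by
  rw [EReal.sub_le_iff_le_add (by simp) (by simp), EReal.coe_add]

/-- A subharmonic function on the plane that is bounded above grows slower than any multiple of the
logarithm. -/
theorem IsSubharmonicOn.le_add_mul_log {u : ℂ → EReal} (hu : IsSubharmonicOn u univ)
    (hu0 : ∀ z, u z ≤ 0) {m ε : ℝ} (hε : 0 < ε) (hm : ∀ z, ‖z‖ = 1 → u z ≤ m) {z : ℂ}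
    (hz : 1 ≤ ‖z‖) : u z ≤ ((m + ε * Real.log ‖z‖ : ℝ) : EReal) := by
  by_contra hcon
  obtain ⟨R, hR⟩ : ∃ R : ℝ, ∀ w : ℂ, R ≤ ‖w‖ → 0 ≤ m + ε * Real.log ‖w‖ := by
    have := Real.tendsto_log_atTop.const_mul_atTop hε
    obtain ⟨R, hR⟩ := (this.eventually_ge_atTop (-m)).exists_forall_of_atTop
    exact ⟨R, fun w hw => by linarith [hR _ hw]⟩
  have hfar : ∀ w : ℂ, R ≤ ‖w‖ → u w - (ε * Real.log ‖w‖ : ℝ) ≤ m := fun w hw =>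
    EReal_sub_coe_le_iff.2 ((hu0 w).trans (by exact_mod_cast hR w hw))
  -- Since `u ≤ 0`, the bound holds for `‖w‖ ≥ R`. A violation would therefore give `u - ε log ‖·‖`
  -- a maximum over `‖w‖ ≥ 1`, attained on this compact annulus.
  set A : Set ℂ := {w | 1 ≤ ‖w‖} ∩ closedBall 0 R with hA
  have hAc : IsCompact A :=
    (isCompact_closedBall 0 R).inter_left (isClosed_le continuous_const continuous_norm)
  have hzA : z ∈ A := by
    refine ⟨hz, mem_closedBall_zero_iff.2 ?_⟩
    by_contra h
    exact hcon (EReal_sub_coe_le_iff.1 (hfar z (not_le.1 h).le))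
  have husc : UpperSemicontinuousOn (fun w => u w - (ε * Real.log ‖w‖ : ℝ)) A := by
    simp only [sub_eq_add_neg, ← EReal.coe_neg]
    refine UpperSemicontinuousOn.add' (hu.1.mono (subset_univ _)) ?_ ?_
    · refine ContinuousOn.upperSemicontinuousOn ?_
      refine continuous_coe_real_ereal.comp_continuousOn fun w hw => ?_
      have : ‖w‖ ≠ 0 := (zero_lt_one.trans_le hw.1).ne'
      exact ContinuousAt.continuousWithinAt (by fun_prop (disch := assumption))
    · intro w _
      exact EReal.continuousAt_add (.inr (EReal.coe_ne_bot _)) (.inr (EReal.coe_ne_top _))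
  obtain ⟨w, hwA, hw⟩ := husc.exists_isMaxOn ⟨z, hzA⟩ hAc
  have hwz : (m : EReal) < u w - (ε * Real.log ‖w‖ : ℝ) := by
    refine lt_of_lt_of_le ?_ (hw hzA)
    rw [← not_le, EReal_sub_coe_le_iff]
    exact hcon
  have hmax : ∀ x : ℂ, 1 ≤ ‖x‖ → u x - (ε * Real.log ‖x‖ : ℝ) ≤ u w - (ε * Real.log ‖w‖ : ℝ) := by
    intro x hx
    by_cases hxR : ‖x‖ ≤ R
    · exact hw ⟨hx, mem_closedBall_zero_iff.2 hxR⟩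
    · exact (hfar x (not_le.1 hxR).le).trans hwz.le
  obtain ⟨q, hq⟩ : ∃ q : ℝ, (q : EReal) = u w - (ε * Real.log ‖w‖ : ℝ) := by
    have h1 : u w ≠ ⊤ := ((hu0 w).trans_lt (by simp)).ne
    have h2 : u w ≠ ⊥ := by rintro h; simp [h] at hwz
    lift u w to ℝ using ⟨h1, h2⟩ with y
    exact ⟨y - ε * Real.log ‖w‖, by rw [EReal.coe_sub]⟩
  rw [← hq] at hwz hmax
  have hmq : m < q := by exact_mod_cast hwz
  have hw1 : 1 < ‖w‖ := by
    refine lt_of_le_of_ne hwA.1 fun h => ?_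
    have := hm w h.symm
    rw [← h] at hq
    simp only [Real.log_one, mul_zero, EReal.coe_zero, sub_zero] at hq
    rw [← hq] at this
    exact hmq.not_ge (by exact_mod_cast this)
  -- The disc about `w` tangent to the unit circle avoids `0`, so `q + ε log ‖x‖` is harmonic on it;
  -- it dominates `u` and equals `u` at `w`. The equality case transports equality to the tangency
  -- point `w / ‖w‖`, where `u ≤ m < q`.
  have hball : ∀ x ∈ closedBall w (‖w‖ - 1), 1 ≤ ‖x‖ := by
    intro x hx
    rw [mem_closedBall, dist_eq_norm] at hx
    have := norm_sub_norm_le w x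
    rw [norm_sub_rev] at this
    linarith
  have hball0 : ∀ x ∈ closedBall w (‖w‖ - 1), x ≠ 0 := fun x hx h => by
    have := hball x hx
    rw [h, norm_zero] at this
    exact zero_lt_one.not_ge this
  have key := le_of_le_circleMean_of_circleAverage_eq (u := u)
    (h := fun x => q + ε * Real.log ‖x‖) (c := w) (r := ‖w‖ - 1) (by linarith)
    (hu.1.mono (subset_univ _)) (hu.2.2 w _ (by linarith) (subset_univ _))
    (fun x hx => by
      have := norm_ne_zero_iff.2 (hball0 x (sphere_subset_closedBall hx))
      exact ContinuousAt.continuousWithinAt (by fun_prop (disch := assumption)))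
    (circleAverage_const_add_mul_log_norm (by linarith) hball0)
    (fun x hx => EReal_sub_coe_le_iff.1 (hmax x (hball x (sphere_subset_closedBall hx))))
    (by
      rw [EReal.coe_add, hq]
      exact EReal.sub_add_cancel.le)
  have hw0 : ‖w‖ ≠ 0 := by linarith
  have hx1 : ‖((‖w‖⁻¹ : ℝ) : ℂ) * w‖ = 1 := by
    rw [norm_mul, Complex.norm_real, norm_inv, norm_norm, inv_mul_cancel₀ hw0]
  have := key (((‖w‖⁻¹ : ℝ) : ℂ) * w) (by
    rw [mem_sphere, dist_eq_norm, ← sub_one_mul, norm_mul, ← Complex.ofReal_one,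
      ← Complex.ofReal_sub, Complex.norm_real, Real.norm_eq_abs, abs_sub_comm,
      abs_of_nonneg (sub_nonneg.2 (inv_le_one_of_one_le₀ hw1.le)), sub_mul, inv_mul_cancel₀ hw0,
      one_mul])
  have h2 := this.trans (hm _ hx1)
  rw [hx1, Real.log_one, mul_zero, add_zero] at h2
  exact hmq.not_ge (by exact_mod_cast h2)

/-- Liouville's theorem for subharmonic functions on the plane. -/
theorem IsSubharmonicOn.eq_of_nonpos {u : ℂ → EReal} (hu : IsSubharmonicOn u univ)
    (hu0 : ∀ z, u z ≤ 0) (z w : ℂ) : u z = u w := by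
  obtain ⟨c, -, hc⟩ := (hu.1.mono (subset_univ (closedBall (0 : ℂ) 1))).exists_isMaxOn
    ⟨0, by simp⟩ (isCompact_closedBall 0 1)
  -- The maximum over the unit disc is global: outside, `u` grows slower than any `ε log ‖z‖`, and
  -- `ε` is chosen below so that the bound becomes an arbitrary `m' > m > u c`.
  have hmax : ∀ z, u z ≤ u c := by
    intro z
    by_cases hz : ‖z‖ ≤ 1
    · exact hc (mem_closedBall_zero_iff.2 hz)
    · refine EReal.le_of_forall_lt_iff_le.1 fun m hm => ?_
      have hlog : 0 < Real.log ‖z‖ := Real.log_pos (not_le.1 hz)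
      refine EReal.le_of_forall_lt_iff_le.1 fun m' hm' => ?_
      have hm'' : m < m' := by exact_mod_cast hm'
      have := hu.le_add_mul_log hu0 (m := m) (ε := (m' - m) / Real.log ‖z‖)
        (div_pos (sub_pos.2 hm'') hlog)
        (fun x hx => (hc (mem_closedBall_zero_iff.2 hx.le)).trans hm.le) (not_le.1 hz).le
      rwa [div_mul_cancel₀ _ hlog.ne', add_sub_cancel] at this
  suffices h : ∀ z, u z = u c by rw [h z, h w]
  intro z
  refine le_antisymm (hmax z) ?_
  by_cases hb : u c = ⊥
  · simp [hb]
  have ht : u c ≠ ⊤ := (hu.2.1 c (mem_univ _)).ne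
  obtain ⟨q, hq⟩ : ∃ q : ℝ, (q : EReal) = u c := ⟨(u c).toReal, EReal.coe_toReal ht hb⟩
  rcases eq_or_ne z c with rfl | hzc
  · exact le_rfl
  rw [← hq]
  -- Strong maximum principle on the circle about `c` through `z`.
  exact le_of_le_circleMean_of_circleAverage_eq (u := u) (h := fun _ => q) (c := c)
    (r := dist z c) (dist_pos.2 hzc) (hu.1.mono (subset_univ _))
    (hu.2.2 c _ (dist_pos.2 hzc) (subset_univ _)) continuousOn_const
    (Real.circleAverage_const q c _) (fun x _ => hq ▸ hmax x) hq.le z rfl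

end

/-! ### Entire curves in elementary Reinhardt domains -/

section
open Metric Filter Topology Set

/-- `v` is constant along every entire curve in `D`. -/
def ConstOnEntireCurves {n : ℕ} {β : Type*} (v : Cn n → β) (D : Set (Cn n)) : Prop :=
  ∀ φ : ℂ → Cn n, Differentiable ℂ φ → (∀ ζ, φ ζ ∈ D) → ∀ ζ ξ, v (φ ζ) = v (φ ξ)

theorem constOnEntireCurves_of_differentiableOn {n : ℕ} {f : Cn n → ℂ} {D : Set (Cn n)}
    (hf : DifferentiableOn ℂ f D) (hfD : MapsTo f D (ball 0 1)) : ConstOnEntireCurves f D := by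
  intro φ hφ hφD ζ ξ
  have hd : Differentiable ℂ (f ∘ φ) :=
    differentiableOn_univ.1 (hf.comp hφ.differentiableOn fun ζ _ => hφD ζ)
  refine hd.apply_eq_apply_of_bounded ((isBounded_ball (x := (0 : ℂ)) (r := 1)).subset ?_) ζ ξ
  rintro _ ⟨ζ, rfl⟩
  exact hfD (hφD ζ)

theorem constOnEntireCurves_of_isLogPSHOn {n : ℕ} {v : Cn n → ℝ} {D : Set (Cn n)}
    (hv : IsLogPSHOn v D) (hvD : ∀ z ∈ D, 0 ≤ v z ∧ v z < 1) : ConstOnEntireCurves v D := by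
  intro φ hφ hφD ζ ξ
  have hs := hv.2.2 univ φ isOpen_univ hφ.differentiableOn fun ζ _ => hφD ζ
  have := hs.eq_of_nonpos (fun z => by
    rw [← ENNReal.log_one]
    exact ENNReal.log_monotone (ENNReal.ofReal_le_one.2 (hvD _ (hφD z)).2.le)) ζ ξ
  have := ENNReal.log_injective this
  rwa [ENNReal.ofReal_eq_ofReal_iff (hvD _ (hφD ζ)).1 (hvD _ (hφD ξ)).1] at this

section Reinhardt
variable {n : ℕ} {α : Fin n → ℝ} {C : ℝ}

theorem isOpen_elemReinhardt : IsOpen (elemReinhardt α C) := by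
  rw [isOpen_iff_mem_nhds]
  rintro z ⟨h1, h2⟩
  refine inter_mem ?_ ?_
  · have : ∀ j, ∀ᶠ w : Cn n in 𝓝 z, α j < 0 → w j ≠ 0 := by
      intro j
      by_cases hj : α j < 0
      · have hc : ContinuousAt (fun w : Cn n => w j) z := by fun_prop
        filter_upwards [hc.eventually_ne (h1 j hj)] with w hw _ using hw
      · exact .of_forall fun w h => absurd h hj
    exact eventually_all.2 this
  · have hc : ContinuousAt (fun w : Cn n => ∏ j, ‖w j‖ ^ α j) z := by
      refine tendsto_finsetProd _ fun j _ => ?_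
      have : ContinuousAt (fun w : Cn n => ‖w j‖) z := by fun_prop
      refine this.rpow_const ?_
      rcases lt_or_ge (α j) 0 with h | h
      · exact .inl (norm_ne_zero_iff.2 (h1 j h))
      · exact .inr h
    exact hc.eventually (gt_mem_nhds h2)

/-- The point with coordinates `z j * exp (c j)`. -/
def expScale (c : Fin n → ℂ) (z : Cn n) : Cn n := WithLp.toLp 2 fun j => z j * Complex.exp (c j)

@[simp] theorem expScale_apply (c : Fin n → ℂ) (z : Cn n) (j : Fin n) :
    expScale c z j = z j * Complex.exp (c j) := rfl

/-- The scaling multiplies `∏ |z_j|^α_j` by `exp(Re ∑ α_j c_j) = 1`. The condition on `c` is complex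
linear, so `μ • c` satisfies it too and gives an entire curve. -/
theorem expScale_mem {z : Cn n} (hz : z ∈ elemReinhardt α C) {c : Fin n → ℂ}
    (hc : ∑ j, (α j : ℂ) * c j = 0) : expScale c z ∈ elemReinhardt α C := by
  refine ⟨fun j hj => mul_ne_zero (hz.1 j hj) (Complex.exp_ne_zero _), ?_⟩
  have h1 : ∏ j, ‖expScale c z j‖ ^ α j = (∏ j, ‖z j‖ ^ α j) * ∏ j, Real.exp (α j * (c j).re) := by
    rw [← Finset.prod_mul_distrib]
    refine Finset.prod_congr rfl fun j _ => ?_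
    rw [expScale_apply, norm_mul, Real.mul_rpow (norm_nonneg _) (norm_nonneg _), Complex.norm_exp,
      ← Real.exp_mul, mul_comm (c j).re]
  have h2 : ∑ j, α j * (c j).re = 0 := by
    have := congrArg Complex.re hc
    simpa using this
  rw [h1, ← Real.exp_sum, h2, Real.exp_zero, mul_one]
  exact hz.2

theorem mem_elemReinhardt_of_apply_eq_zero (hα : ∀ j, α j ≠ 0) {z : Cn n}
    (h : ∀ j, α j < 0 → z j ≠ 0) {i : Fin n} (hi : z i = 0) : z ∈ elemReinhardt α C := by
  refine ⟨h, ?_⟩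
  rw [Finset.prod_eq_zero (Finset.mem_univ i)]
  · exact Real.exp_pos C
  · rw [hi, norm_zero, Real.zero_rpow (hα i)]

theorem pos_of_mem_of_apply_eq_zero (hα : ∀ j, α j ≠ 0) {a : Cn n} (ha : a ∈ elemReinhardt α C)
    {i : Fin n} (hi : a i = 0) : 0 < α i :=
  (lt_or_gt_of_ne (hα i)).resolve_left fun h => ha.1 i h hi

theorem single_smul_apply (a : Cn n) (t : ℂ) (k j : Fin n) :
    (a + t • EuclideanSpace.single k (1 : ℂ)) j = if j = k then a k + t else a j := by
  by_cases h : j = k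
  · subst h; simp
  · simp [h]

/-- An entire curve in `D` through `a` in the direction of a coordinate axis, when another coordinate
of `a` vanishes. -/
theorem exists_entire_curve (hα : ∀ j, α j ≠ 0) {a : Cn n} (ha : a ∈ elemReinhardt α C)
    {i k : Fin n} (hik : i ≠ k) (hi : a i = 0) :
    ∃ g : ℂ → ℂ, Differentiable ℂ g ∧ g 0 = 0 ∧ deriv g 0 = 1 ∧
      ∀ ζ, a + g ζ • EuclideanSpace.single k (1 : ℂ) ∈ elemReinhardt α C := by
  by_cases hk : a k = 0
  · refine ⟨id, differentiable_id, rfl, deriv_id _, fun ζ =>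
      mem_elemReinhardt_of_apply_eq_zero hα (i := i) ?_ ?_⟩
    · intro j hj
      rw [single_smul_apply, if_neg]
      · exact ha.1 j hj
      · rintro rfl
        exact (pos_of_mem_of_apply_eq_zero hα ha hk).not_gt hj
    · rw [single_smul_apply, if_neg hik, hi]
  -- The `k`-th coordinate becomes `a_k exp(ζ / a_k)`, which never vanishes, as required when `α_k <
  -- 0`.
  · refine ⟨fun ζ => a k * (Complex.exp (ζ / a k) - 1), by fun_prop, by simp, ?_, fun ζ =>
      mem_elemReinhardt_of_apply_eq_zero hα (i := i) ?_ ?_⟩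
    · have : HasDerivAt (fun ζ => a k * (Complex.exp (ζ / a k) - 1))
          (a k * (Complex.exp (0 / a k) * (1 / a k))) 0 :=
        ((((hasDerivAt_id (0 : ℂ)).div_const (a k)).cexp).sub_const 1).const_mul (a k)
      rw [this.deriv, zero_div, Complex.exp_zero]
      field_simp
    · intro j hj
      rw [single_smul_apply]
      split_ifs with h
      · simp only [mul_sub, mul_one, add_sub_cancel]
        exact mul_ne_zero hk (Complex.exp_ne_zero _)
      · exact ha.1 j hj
    · rw [single_smul_apply, if_neg hik, hi]

/-- The curve has the form `a + g(ζ) e_k` with `g'(0) = 1`, so `g` is a local homeomorphism at `0`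
and covers all small `t`. -/
theorem eventually_eq_along_axis {β : Type*} {v : Cn n → β} (hα : ∀ j, α j ≠ 0)
    (hv : ConstOnEntireCurves v (elemReinhardt α C))
    {a : Cn n} (ha : a ∈ elemReinhardt α C) {i k : Fin n} (hik : i ≠ k) (hi : a i = 0) :
    ∀ᶠ t : ℂ in 𝓝 0, v (a + t • EuclideanSpace.single k (1 : ℂ)) = v a := by
  obtain ⟨g, hg, hg0, hg1, hgD⟩ := exists_entire_curve hα ha hik hi
  have hs : HasStrictDerivAt g 1 0 := by
    rw [← hg1]
    exact hg.contDiff.contDiffAt.hasStrictDerivAt (n := 1) (by simp)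
  have := hs.map_nhds_eq one_ne_zero
  rw [hg0] at this
  rw [← this, eventually_map]
  refine .of_forall fun ζ => ?_
  have := hv (fun ζ => a + g ζ • EuclideanSpace.single k (1 : ℂ)) (by fun_prop) hgD ζ 0
  simpa [hg0] using this

end Reinhardt

end

/-! ### The leaf coordinate near a point with at most one zero coordinate -/

section
open Metric Filter Topology Set

section Leaf
variable {n : ℕ}

/-- The coordinate on the axis `a + ℂ eᵢ` of the point in which it meets the leaf
`∏ z_j ^ α_j = const` through `z`. -/
def leafCoord (α : Fin n → ℝ) (a : Cn n) (i : Fin n) (z : Cn n) : ℂ :=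
  z i * Complex.exp (∑ j ∈ Finset.univ.erase i, (α j / α i : ℂ) * Complex.log (z j / a j)) - a i

/-- The derivative of `leafCoord α a i` at `a`. -/
def leafForm (α : Fin n → ℝ) (a : Cn n) (i : Fin n) : Cn n →ₗ[ℂ] ℂ :=
  (EuclideanSpace.proj i : Cn n →L[ℂ] ℂ).toLinearMap +
    ∑ j ∈ Finset.univ.erase i,
      (a i * ((α j / α i : ℂ) / a j)) • (EuclideanSpace.proj j : Cn n →L[ℂ] ℂ).toLinearMap

theorem leafForm_apply (α : Fin n → ℝ) (a : Cn n) (i : Fin n) (X : Cn n) :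
    leafForm α a i X =
      X i + a i * ∑ j ∈ Finset.univ.erase i, (α j / α i : ℂ) * (X j / a j) := by
  simp only [leafForm, LinearMap.add_apply, LinearMap.sum_apply, LinearMap.smul_apply,
    ContinuousLinearMap.coe_coe, PiLp.proj_apply, smul_eq_mul, Finset.mul_sum]
  congr 1
  refine Finset.sum_congr rfl fun j _ => ?_
  ring

variable {α : Fin n → ℝ} {C : ℝ} {a : Cn n} {i : Fin n}

theorem leafForm_single : leafForm α a i (EuclideanSpace.single i 1) = 1 := by
  rw [leafForm_apply, Finset.sum_eq_zero]
  · simp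
  · intro j hj
    simp [(Finset.mem_erase.1 hj).1]

theorem leafCoord_add_smul_single (ha : ∀ j ≠ i, a j ≠ 0) (t : ℂ) :
    leafCoord α a i (a + t • EuclideanSpace.single i 1) = t := by
  rw [leafCoord, Finset.sum_eq_zero, single_smul_apply, if_pos rfl]
  · simp
  · intro j hj
    have hj := (Finset.mem_erase.1 hj).1
    rw [single_smul_apply, if_neg hj, div_self (ha j hj), Complex.log_one, mul_zero]

theorem leafCoord_self (ha : ∀ j ≠ i, a j ≠ 0) : leafCoord α a i a = 0 := by
  simpa using leafCoord_add_smul_single (α := α) ha 0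

theorem analyticAt_leafCoord (ha : ∀ j ≠ i, a j ≠ 0) : AnalyticAt ℂ (leafCoord α a i) a := by
  have hp : ∀ j, AnalyticAt ℂ (fun z : Cn n => z j) a := fun j =>
    (EuclideanSpace.proj j : Cn n →L[ℂ] ℂ).analyticAt a
  refine ((hp i).mul (AnalyticAt.cexp ?_)).sub analyticAt_const
  refine Finset.analyticAt_fun_sum _ fun j hj => analyticAt_const.mul ?_
  have hj := ha j (Finset.mem_erase.1 hj).1
  exact ((hp j).div analyticAt_const hj).clog (by simp [div_self hj])

theorem hasDerivAt_leafCoord_line (ha : ∀ j ≠ i, a j ≠ 0) (X : Cn n) :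
    HasDerivAt (fun t : ℂ => leafCoord α a i (a + t • X)) (leafForm α a i X) 0 := by
  have hl : ∀ j, HasDerivAt (fun t : ℂ => (a + t • X) j) (X j) 0 := fun j => by
    simpa using ((hasDerivAt_id (0 : ℂ)).mul_const (X j)).const_add (a j)
  have hlog : ∀ j ≠ i, HasDerivAt (fun t : ℂ => Complex.log ((a + t • X) j / a j)) (X j / a j) 0 := by
    intro j hj
    have := ((hl j).div_const (a j)).clog (by simp [div_self (ha j hj)])
    simpa [div_self (ha j hj)] using this
  have hs : HasDerivAt (fun t : ℂ => ∑ j ∈ Finset.univ.erase i,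
      (α j / α i : ℂ) * Complex.log ((a + t • X) j / a j))
      (∑ j ∈ Finset.univ.erase i, (α j / α i : ℂ) * (X j / a j)) 0 :=
    HasDerivAt.fun_sum fun j hj => (hlog j (Finset.mem_erase.1 hj).1).const_mul _
  have hs0 : ∑ j ∈ Finset.univ.erase i,
      (α j / α i : ℂ) * Complex.log ((a + (0 : ℂ) • X) j / a j) = 0 := by
    refine Finset.sum_eq_zero fun j hj => ?_
    simp [div_self (ha j (Finset.mem_erase.1 hj).1)]
  have := ((hl i).mul hs.cexp).sub_const (a i)
  rw [hs0] at this
  refine this.congr_deriv ?_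
  rw [leafForm_apply]
  simp

theorem hasStrictDerivAt_leafCoord_line (ha : ∀ j ≠ i, a j ≠ 0) (X : Cn n) :
    HasStrictDerivAt (fun t : ℂ => leafCoord α a i (a + t • X)) (leafForm α a i X) 0 := by
  rw [← (hasDerivAt_leafCoord_line ha X).deriv]
  refine AnalyticAt.hasStrictDerivAt ?_
  have h : AnalyticAt ℂ (fun t : ℂ => a + t • X) 0 := by fun_prop
  refine AnalyticAt.fun_comp ?_ h
  simpa using analyticAt_leafCoord ha

/-- Taking `c_j = -log(z_j / a_j)` for `j ≠ i` and solving `∑ α_j c_j = 0` for `c_i` gives an entire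
curve `expScale (μ • c) z` from `z` at `μ = 0` to the axis `a + ℂ e_i` at `μ = 1`. Only `exp ∘ log =
id` is used, so the branch of the logarithm is immaterial. -/
theorem apply_eq_apply_leafCoord {β : Type*} {v : Cn n → β} (hα : ∀ j, α j ≠ 0)
    (hv : ConstOnEntireCurves v (elemReinhardt α C)) (ha : ∀ j ≠ i, a j ≠ 0) {z : Cn n}
    (hz : z ∈ elemReinhardt α C) (hz0 : ∀ j ≠ i, z j ≠ 0) :
    v z = v (a + leafCoord α a i z • EuclideanSpace.single i (1 : ℂ)) := by
  set S := ∑ j ∈ Finset.univ.erase i, (α j / α i : ℂ) * Complex.log (z j / a j) with hS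
  set c : Fin n → ℂ := fun j => if j = i then S else -Complex.log (z j / a j) with hc
  have hci : c i = S := if_pos rfl
  have hcj : ∀ j ≠ i, c j = -Complex.log (z j / a j) := fun j hj => if_neg hj
  have hαi : (α i : ℂ) ≠ 0 := by exact_mod_cast hα i
  have hsum : ∑ j, (α j : ℂ) * c j = 0 := by
    rw [← Finset.add_sum_erase _ _ (Finset.mem_univ i), hci, hS, Finset.mul_sum,
      ← Finset.sum_add_distrib]
    refine Finset.sum_eq_zero fun j hj => ?_
    rw [hcj j (Finset.mem_erase.1 hj).1]
    field_simp
    ring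
  have hd : Differentiable ℂ fun μ : ℂ => expScale (μ • c) z := by
    refine differentiable_euclidean.2 fun j => ?_
    simp only [expScale_apply, Pi.smul_apply, smul_eq_mul]
    fun_prop
  have := hv _ hd (fun μ => expScale_mem hz (by
    simp only [Pi.smul_apply, smul_eq_mul, mul_left_comm _ μ, ← Finset.mul_sum, hsum,
      mul_zero])) 0 1
  convert this using 2
  · ext j; simp
  · ext j
    rw [single_smul_apply, one_smul, expScale_apply]
    split_ifs with h
    · rw [h, hci, leafCoord, add_sub_cancel]
    · rw [hcj j h, Complex.exp_neg, Complex.exp_log (div_ne_zero (hz0 j h) (ha j h))]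
      have := hz0 j h
      field_simp

/-- Near `a`, functions constant along entire curves factor through `leafCoord`. -/
theorem eventually_eq_leafCoord {β : Type*} {v : Cn n → β} (hα : ∀ j, α j ≠ 0)
    (hv : ConstOnEntireCurves v (elemReinhardt α C)) (ha : ∀ j ≠ i, a j ≠ 0)
    (haD : a ∈ elemReinhardt α C) :
    ∀ᶠ z in 𝓝 a, v z = v (a + leafCoord α a i z • EuclideanSpace.single i (1 : ℂ)) := by
  have h0 : ∀ᶠ z : Cn n in 𝓝 a, ∀ j ≠ i, z j ≠ 0 := by
    refine eventually_all.2 fun j => ?_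
    by_cases hj : j = i
    · exact .of_forall fun _ h => absurd hj h
    · have hc : ContinuousAt (fun w : Cn n => w j) a := by fun_prop
      filter_upwards [hc.eventually_ne (ha j hj)] with w hw _ using hw
  filter_upwards [isOpen_elemReinhardt.mem_nhds haD, h0] with z hz hz0
  exact apply_eq_apply_leafCoord hα hv ha hz hz0

end Leaf

theorem map_nhdsNE_of_hasStrictDerivAt {H : ℂ → ℂ} {d : ℂ} (hH : HasStrictDerivAt H d 0)
    (hd : d ≠ 0) (H0 : H 0 = 0) : map H (𝓝[≠] 0) = 𝓝[≠] 0 := by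
  have hmap := hH.map_nhds_eq hd
  rw [H0] at hmap
  have hne : ∀ᶠ t in 𝓝 (0 : ℂ), t ≠ 0 → H t ≠ 0 := by
    have := eventually_nhdsWithin_iff.1 (hH.hasDerivAt.eventually_ne (c := 0) hd)
    exact this
  ext s
  change (∀ᶠ t in 𝓝[≠] 0, H t ∈ s) ↔ ∀ᶠ t in 𝓝[≠] 0, t ∈ s
  rw [eventually_nhdsWithin_iff, eventually_nhdsWithin_iff]
  conv_rhs => rw [← hmap, eventually_map]
  refine eventually_congr (hne.mono fun t ht => ?_)
  by_cases h : t = 0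
  · simp [h, H0]
  · simp [h, ht h]

/-- A chain rule for a `w` that need not be differentiable. For `d ≠ 0` the map `H` preserves the
punctured neighbourhoods of `0`, and `‖H t‖ / ‖t‖ → ‖d‖` factors out of the limsup; for `d = 0` the
linear bound on `w` squeezes the quotient to `0`. -/
theorem limsup_comp_div_norm {w : ℂ → ℝ} {M : ℝ}
    (hw : ∀ᶠ t in 𝓝 (0 : ℂ), 0 ≤ w t ∧ w t ≤ M * ‖t‖) {H : ℂ → ℂ} {d : ℂ}
    (hH : HasStrictDerivAt H d 0) (H0 : H 0 = 0) :
    limsup (fun t => w (H t) / ‖t‖) (𝓝[≠] 0) =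
      ‖d‖ * limsup (fun t => w t / ‖t‖) (𝓝[≠] 0) := by
  have hρ : Tendsto (fun t => ‖H t‖ / ‖t‖) (𝓝[≠] 0) (𝓝 ‖d‖) := by
    have := (hasDerivAt_iff_tendsto_slope.1 hH.hasDerivAt).norm
    refine this.congr fun t => ?_
    rw [slope_def_field, H0, sub_zero, sub_zero, norm_div]
  have hwH : ∀ᶠ t in 𝓝[≠] (0 : ℂ), 0 ≤ w (H t) ∧ w (H t) ≤ M * ‖H t‖ := by
    have hc : Tendsto H (𝓝 0) (𝓝 0) := by
      have := hH.hasDerivAt.continuousAt.tendsto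
      rwa [H0] at this
    exact (hc.eventually hw).filter_mono nhdsWithin_le_nhds
  rcases eq_or_ne d 0 with rfl | hd
  · rw [norm_zero, zero_mul]
    refine Tendsto.limsup_eq ?_
    have h2 := hρ.const_mul M
    rw [norm_zero, mul_zero] at h2
    refine tendsto_of_tendsto_of_tendsto_of_le_of_le' tendsto_const_nhds h2 ?_ ?_
    · filter_upwards [hwH] with t ht using div_nonneg ht.1 (norm_nonneg _)
    · filter_upwards [hwH] with t ht
      rw [← mul_div_assoc]
      exact div_le_div_of_nonneg_right ht.2 (norm_nonneg _)
  · have hmap := map_nhdsNE_of_hasStrictDerivAt hH hd H0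
    set F : ℂ → ℝ := fun t => w t / ‖t‖ with hF
    have hFH : limsup (F ∘ H) (𝓝[≠] 0) = limsup F (𝓝[≠] 0) := by
      conv_rhs => rw [← hmap]
      rfl
    have hne : ∀ᶠ t in 𝓝[≠] (0 : ℂ), H t ≠ 0 := hH.hasDerivAt.eventually_ne hd
    have hF0 : ∀ᶠ t in 𝓝[≠] (0 : ℂ), 0 ≤ (F ∘ H) t ∧ (F ∘ H) t ≤ M := by
      filter_upwards [hwH, hne] with t ht hn
      exact ⟨div_nonneg ht.1 (norm_nonneg _), (div_le_iff₀ (norm_pos_iff.2 hn)).2 ht.2⟩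
    have heq : (fun t => w (H t) / ‖t‖) =ᶠ[𝓝[≠] 0] (F ∘ H) * fun t => ‖H t‖ / ‖t‖ := by
      filter_upwards [hne] with t hn
      have := norm_ne_zero_iff.2 hn
      simp only [hF, Function.comp, Pi.mul_apply]
      field_simp
    rw [limsup_congr heq, ← hFH, mul_comm ‖d‖]
    have hb : IsBoundedUnder (· ≤ ·) (𝓝[≠] (0 : ℂ)) (F ∘ H) :=
      ⟨M, eventually_map.2 (hF0.mono fun _ h => h.2)⟩
    have hρ0 : 0 ≤ᶠ[𝓝[≠] (0 : ℂ)] fun t => ‖H t‖ / ‖t‖ := .of_forall fun t => by positivity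
    refine le_antisymm ?_ ?_
    · refine (limsup_mul_le (hF0.mono fun _ h => h.1).frequently hb hρ0
        hρ.isBoundedUnder_le).trans ?_
      rw [hρ.limsup_eq]
    · rw [← hρ.liminf_eq]
      exact le_limsup_mul (hF0.mono fun _ h => h.1).frequently hb hρ0 hρ.isBoundedUnder_le

end

/-! ### The three pseudometrics as multiples of the leaf form -/

section
open Metric Filter Topology Set

/-- Scaling by `c ≥ 0` is compatible with the default value of `sSup`, so neither boundedness nor
nonemptiness is needed. -/
theorem sSup_setOf_eq_mul {ι : Type*} {P : ι → Prop} {T T' : ι → ℝ} {c : ℝ} (hc : 0 ≤ c)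
    (h : ∀ f, P f → T f = c * T' f) :
    sSup {t | ∃ f, P f ∧ t = T f} = c * sSup {t | ∃ f, P f ∧ t = T' f} := by
  rw [← smul_eq_mul, ← Real.sSup_smul_of_nonneg hc]
  congr 1
  ext t
  simp only [mem_smul_set, mem_ofPred_eq, smul_eq_mul]
  constructor
  · rintro ⟨f, hf, rfl⟩
    exact ⟨_, ⟨f, hf, rfl⟩, (h f hf).symm⟩
  · rintro ⟨_, ⟨f, hf, rfl⟩, rfl⟩
    exact ⟨f, hf, (h f hf).symm⟩

section Line
variable {E : Type*} [NormedAddCommGroup E] [NormedSpace ℂ E]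

theorem hasDerivAt_iteratedFDeriv_line {f : E → ℂ} {a X : E} {j : ℕ} {t : ℂ}
    (h : DifferentiableAt ℂ (iteratedFDeriv ℂ j f) (a + t • X)) :
    HasDerivAt (fun s : ℂ => iteratedFDeriv ℂ j f (a + s • X) (fun _ => X))
      (iteratedFDeriv ℂ (j + 1) f (a + t • X) (fun _ => X)) t := by
  have hl : HasDerivAt (fun s : ℂ => a + s • X) X t := by
    simpa using ((hasDerivAt_id t).smul_const X).const_add a
  have := h.hasFDerivAt.comp_hasDerivAt t hl
  exact ((ContinuousMultilinearMap.apply ℂ (fun _ : Fin j => E) ℂ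
    (fun _ => X)).hasFDerivAt.comp_hasDerivAt t this)

theorem eventually_iteratedFDeriv_line_eq_zero {f : E → ℂ} {a X : E}
    (h : ∀ᶠ t : ℂ in 𝓝 0, f (a + t • X) = 0) (j : ℕ) :
    ∀ᶠ t : ℂ in 𝓝 0, iteratedFDeriv ℂ j f (a + t • X) (fun _ => X) = 0 := by
  induction j with
  | zero => simpa using h
  | succ j ih =>
    filter_upwards [ih.eventually_nhds] with t ht
    by_cases hd : DifferentiableAt ℂ (iteratedFDeriv ℂ j f) (a + t • X)
    · rw [← (hasDerivAt_iteratedFDeriv_line hd).deriv]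
      have : (fun s : ℂ => iteratedFDeriv ℂ j f (a + s • X) (fun _ => X)) =ᶠ[𝓝 t] fun _ => 0 := ht
      rw [this.deriv_eq, deriv_const]
    -- Where the `j`-th derivative is not differentiable, the next one is zero by default, so no
    -- smoothness of `f` is needed.
    · rw [iteratedFDeriv_succ_apply_left, fderiv_zero_of_not_differentiableAt hd]
      simp

theorem eventually_iteratedFDeriv_line_eq {f : E → ℂ} {a : E} (hf : AnalyticAt ℂ f a) (X : E)
    (j : ℕ) : ∀ᶠ t : ℂ in 𝓝 0, iteratedFDeriv ℂ j f (a + t • X) (fun _ => X) =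
      iteratedDeriv j (fun s : ℂ => f (a + s • X)) t := by
  induction j with
  | zero => simp
  | succ j ih =>
    have hl : Tendsto (fun t : ℂ => a + t • X) (𝓝 0) (𝓝 a) := by
      have : Continuous fun t : ℂ => a + t • X := by fun_prop
      simpa using this.tendsto 0
    filter_upwards [ih.eventually_nhds, hl.eventually hf.eventually_analyticAt] with t ht hat
    have hd : DifferentiableAt ℂ (iteratedFDeriv ℂ j f) (a + t • X) := by
      exact (hat.contDiffAt (n := (j + 1 : ℕ))).differentiableAt_iteratedFDeriv
        (by exact_mod_cast j.lt_succ_self)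
    rw [iteratedDeriv_succ, ← (hasDerivAt_iteratedFDeriv_line hd).deriv]
    exact EventuallyEq.deriv_eq ht

theorem iteratedFDeriv_apply_const_eq {f : E → ℂ} {a : E} (hf : AnalyticAt ℂ f a) (X : E)
    (j : ℕ) : iteratedFDeriv ℂ j f a (fun _ => X) =
      iteratedDeriv j (fun s : ℂ => f (a + s • X)) 0 := by
  simpa using (eventually_iteratedFDeriv_line_eq hf X j).self_of_nhds

end Line

theorem iteratedDeriv_eq_factorial_mul {k : ℕ} : ∀ {g G : ℂ → ℂ}, AnalyticAt ℂ G 0 →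
    (∀ᶠ t in 𝓝 0, g t = t ^ k * G t) → iteratedDeriv k g 0 = k.factorial * G 0 := by
  induction k with
  | zero => intro g G _ h; simpa using h.self_of_nhds
  | succ k ih =>
    intro g G hG h
    -- Differentiating `t^(k+1) G` gives `t^k ((k+1) G + t G')`, whose second factor is `(k+1) G(0)`
    -- at `0`.
    rw [iteratedDeriv_succ', ih (G := fun t => (k + 1) * G t + t * deriv G t)]
    · simp [Nat.factorial_succ]; ring
    · have := hG.deriv
      fun_prop
    · filter_upwards [h.eventually_nhds, hG.eventually_analyticAt] with t ht hGt
      have h1 : g =ᶠ[𝓝 t] fun t => t ^ (k + 1) * G t := ht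
      rw [h1.deriv_eq]
      have := ((hasDerivAt_pow (k + 1) t).fun_mul hGt.differentiableAt.hasDerivAt).deriv
      rw [this]
      push_cast
      ring

/-- The leading Taylor coefficient of a composition. -/
theorem iteratedDeriv_comp_of_order {w H : ℂ → ℂ} {k : ℕ} (hw : AnalyticAt ℂ w 0)
    (hw0 : ∀ j < k, iteratedDeriv j w 0 = 0) (hH : AnalyticAt ℂ H 0) (H0 : H 0 = 0) :
    iteratedDeriv k (fun t => w (H t)) 0 = deriv H 0 ^ k * iteratedDeriv k w 0 := by
  -- With `w = t^k W` and `H = t K`, the composition is `t^k (K^k · W ∘ H)`.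
  obtain ⟨W, hW, hwW⟩ := (natCast_le_analyticOrderAt hw).1
    ((natCast_le_analyticOrderAt_iff_iteratedDeriv_eq_zero hw).2 hw0)
  obtain ⟨K, hK, hHK⟩ := (natCast_le_analyticOrderAt (n := 1) hH).1
    ((natCast_le_analyticOrderAt_iff_iteratedDeriv_eq_zero hH).2 fun j hj => by
      simpa [Nat.lt_one_iff.1 hj] using H0)
  simp only [sub_zero, smul_eq_mul] at hwW hHK
  have hd : deriv H 0 = K 0 := by
    have := iteratedDeriv_eq_factorial_mul hK hHK
    simpa using this
  have hHt : Tendsto H (𝓝 0) (𝓝 0) := by simpa [H0] using hH.continuousAt.tendsto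
  have hWH : AnalyticAt ℂ (fun t => W (H t)) 0 := AnalyticAt.fun_comp (by rwa [H0]) hH
  rw [iteratedDeriv_eq_factorial_mul hW hwW, hd,
    iteratedDeriv_eq_factorial_mul (G := fun t => K t ^ k * W (H t))]
  · rw [H0]; ring
  · exact (hK.pow k).mul hWH
  · filter_upwards [hHK, hHt.eventually hwW] with t h1 h2
    rw [h2]
    nth_rw 1 [h1]
    ring

section Metrics
variable {n : ℕ} {α : Fin n → ℝ} {C : ℝ} {a : Cn n} {i : Fin n}

theorem tendsto_line (a X : Cn n) : Tendsto (fun t : ℂ => a + t • X) (𝓝 0) (𝓝 a) := by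
  have : Continuous fun t : ℂ => a + t • X := by fun_prop
  simpa using this.tendsto 0

theorem iteratedFDeriv_eq_leafForm_pow_mul (hα : ∀ j, α j ≠ 0) (ha : ∀ j ≠ i, a j ≠ 0)
    (haD : a ∈ elemReinhardt α C) {f : Cn n → ℂ} (hf : DifferentiableOn ℂ f (elemReinhardt α C))
    (hfD : MapsTo f (elemReinhardt α C) (ball 0 1)) {k : ℕ}
    (hf0 : ∀ j < k, iteratedFDeriv ℂ j f a = 0) (X : Cn n) :
    iteratedFDeriv ℂ k f a (fun _ => X) = leafForm α a i X ^ k *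
      iteratedFDeriv ℂ k f a (fun _ => EuclideanSpace.single i 1) := by
  set e : Cn n := EuclideanSpace.single i 1 with he
  have hev := eventually_eq_leafCoord hα (constOnEntireCurves_of_differentiableOn hf hfD) ha haD
  have hw : AnalyticAt ℂ (fun t : ℂ => f (a + t • e)) 0 := by
    refine Complex.analyticAt_iff_eventually_differentiableAt.2 ?_
    filter_upwards [(tendsto_line a e).eventually (isOpen_elemReinhardt.eventually_mem haD)]
      with t ht
    have h1 := hf.differentiableAt (isOpen_elemReinhardt.mem_nhds ht)
    exact DifferentiableAt.comp t h1 (by fun_prop)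
  -- Analyticity in several variables comes from the factorization: `f` is a holomorphic function of
  -- one variable composed with the analytic `leafCoord`.
  have hfa : AnalyticAt ℂ f a := by
    refine AnalyticAt.congr (f := fun z => f (a + leafCoord α a i z • e)) ?_
      (hev.mono fun z h => h.symm)
    exact AnalyticAt.fun_comp (g := fun t : ℂ => f (a + t • e)) (by rwa [leafCoord_self ha])
      (analyticAt_leafCoord ha)
  have hHa : AnalyticAt ℂ (fun t : ℂ => leafCoord α a i (a + t • X)) 0 := by
    have h : AnalyticAt ℂ (fun t : ℂ => a + t • X) 0 := by fun_prop
    refine AnalyticAt.fun_comp ?_ h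
    simpa using analyticAt_leafCoord ha
  have hcomp : (fun t : ℂ => f (a + t • X)) =ᶠ[𝓝 0]
      fun t => (fun t : ℂ => f (a + t • e)) (leafCoord α a i (a + t • X)) :=
    (tendsto_line a X).eventually hev
  rw [iteratedFDeriv_apply_const_eq hfa, iteratedFDeriv_apply_const_eq hfa,
    hcomp.iteratedDeriv_eq, iteratedDeriv_comp_of_order hw ?_ hHa (by simpa using leafCoord_self ha),
    (hasDerivAt_leafCoord_line ha X).deriv]
  intro j hj
  rw [← iteratedFDeriv_apply_const_eq hfa, hf0 j hj]
  simp

theorem caratheodoryReiffen_eq (hα : ∀ j, α j ≠ 0) (ha : ∀ j ≠ i, a j ≠ 0)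
    (haD : a ∈ elemReinhardt α C) {k : ℕ} (hk : 1 ≤ k) (X : Cn n) :
    caratheodoryReiffen k (elemReinhardt α C) a X = ‖leafForm α a i X‖ *
      caratheodoryReiffen k (elemReinhardt α C) a (EuclideanSpace.single i 1) := by
  simp only [caratheodoryReiffen, ← and_assoc]
  refine sSup_setOf_eq_mul (norm_nonneg _) ?_
  rintro f ⟨⟨hf, hfD⟩, hf0⟩
  rw [iteratedFDeriv_eq_leafForm_pow_mul hα ha haD hf hfD hf0, mul_left_comm, norm_mul, norm_pow,
    Real.mul_rpow (by positivity) (by positivity), one_div,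
    Real.pow_rpow_inv_natCast (norm_nonneg _) (by omega)]

theorem caratheodoryReiffen_single_eq_zero (hα : ∀ j, α j ≠ 0) (haD : a ∈ elemReinhardt α C)
    {l : Fin n} (hil : i ≠ l) (hi : a i = 0) {k : ℕ} (hk : 1 ≤ k) :
    caratheodoryReiffen k (elemReinhardt α C) a (EuclideanSpace.single l 1) = 0 := by
  refine le_antisymm (Real.sSup_nonpos ?_) (Real.sSup_nonneg ?_)
  · rintro _ ⟨f, hf, hfD, hf0, rfl⟩
    have hfa : f a = 0 := by
      simpa using congrArg (fun L => L fun _ => (0 : Cn n)) (hf0 0 (by omega))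
    have hev := eventually_eq_along_axis hα (constOnEntireCurves_of_differentiableOn hf hfD)
      haD hil hi
    rw [hfa] at hev
    have := (eventually_iteratedFDeriv_line_eq_zero hev k).self_of_nhds
    rw [zero_smul, add_zero] at this
    rw [this, mul_zero, norm_zero, Real.zero_rpow]
    simp; omega
  · rintro _ ⟨f, -, -, -, rfl⟩
    positivity

theorem caratheodoryReiffen_nonneg {k : ℕ} {D : Set (Cn n)} {X : Cn n} :
    0 ≤ caratheodoryReiffen k D a X := by
  refine Real.sSup_nonneg ?_
  rintro _ ⟨f, -, -, -, rfl⟩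
  positivity

theorem limsup_nonneg_of_nonneg {D : Set (Cn n)} (hD : IsOpen D) (haD : a ∈ D) {v : Cn n → ℝ}
    (hv : ∀ z ∈ D, 0 ≤ v z) (X : Cn n) :
    0 ≤ limsup (fun l : ℂ => v (a + l • X) / ‖l‖) (𝓝[≠] 0) := by
  rw [limsup_eq]
  refine Real.sInf_nonneg fun b hb => ?_
  have h1 : ∀ᶠ t : ℂ in 𝓝[≠] 0, a + t • X ∈ D :=
    ((tendsto_line a X).eventually (hD.eventually_mem haD)).filter_mono nhdsWithin_le_nhds
  have hb : ∀ᶠ t : ℂ in 𝓝[≠] 0, v (a + t • X) / ‖t‖ ≤ b := hb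
  obtain ⟨t, ht, ht'⟩ := (hb.and h1).exists
  exact (div_nonneg (hv _ ht') (norm_nonneg _)).trans ht

theorem azukawa_nonneg {D : Set (Cn n)} (hD : IsOpen D) (haD : a ∈ D) {X : Cn n} :
    0 ≤ azukawa D a X := by
  refine Real.sSup_nonneg ?_
  rintro _ ⟨v, hv, -, -, rfl⟩
  exact limsup_nonneg_of_nonneg hD haD (fun z hz => (hv z hz).1) X

theorem azukawa_eq (hα : ∀ j, α j ≠ 0) (ha : ∀ j ≠ i, a j ≠ 0)
    (haD : a ∈ elemReinhardt α C) (X : Cn n) :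
    azukawa (elemReinhardt α C) a X = ‖leafForm α a i X‖ *
      azukawa (elemReinhardt α C) a (EuclideanSpace.single i 1) := by
  simp only [azukawa, ← and_assoc]
  refine sSup_setOf_eq_mul (norm_nonneg _) ?_
  rintro v ⟨⟨hv, hpsh⟩, M, hM, r, hr, hbd⟩
  set e : Cn n := EuclideanSpace.single i 1 with he
  have hev := eventually_eq_leafCoord hα (constOnEntireCurves_of_isLogPSHOn hpsh hv) ha haD
  have hw : ∀ᶠ t in 𝓝 (0 : ℂ), 0 ≤ v (a + t • e) ∧ v (a + t • e) ≤ M * ‖t‖ := by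
    filter_upwards [(tendsto_line a e).eventually (isOpen_elemReinhardt.eventually_mem haD),
      ball_mem_nhds 0 hr] with t ht htr
    have hn : ‖a + t • e - a‖ = ‖t‖ := by
      rw [add_sub_cancel_left, norm_smul, he]; simp
    refine ⟨(hv _ ht).1, ?_⟩
    have := hbd _ ht (by rw [hn]; simpa using htr)
    rwa [hn] at this
  rw [← limsup_comp_div_norm hw (hasStrictDerivAt_leafCoord_line ha X)
    (by simpa using leafCoord_self ha)]
  refine limsup_congr ?_
  filter_upwards [((tendsto_line a X).eventually hev).filter_mono nhdsWithin_le_nhds] with t ht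
  rw [ht]

theorem azukawa_single_eq_zero (hα : ∀ j, α j ≠ 0) (haD : a ∈ elemReinhardt α C)
    {l : Fin n} (hil : i ≠ l) (hi : a i = 0) :
    azukawa (elemReinhardt α C) a (EuclideanSpace.single l 1) = 0 := by
  refine le_antisymm (Real.sSup_nonpos ?_) (azukawa_nonneg isOpen_elemReinhardt haD)
  rintro _ ⟨v, hv, hpsh, ⟨M, hM, r, hr, hbd⟩, rfl⟩
  have hva : v a = 0 := le_antisymm (by simpa using hbd a haD (by simpa using hr)) (hv a haD).1
  have hev := eventually_eq_along_axis hα (constOnEntireCurves_of_isLogPSHOn hpsh hv) haD hil hi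
  refine le_of_eq (Tendsto.limsup_eq (tendsto_const_nhds.congr' ?_))
  filter_upwards [hev.filter_mono nhdsWithin_le_nhds] with t ht
  rw [ht, hva, zero_div]

theorem kobayashiRoyden_nonneg {D : Set (Cn n)} {X : Cn n} : 0 ≤ kobayashiRoyden D a X :=
  Real.sInf_nonneg fun _ h => h.1.le

/-- The discs `ζ ↦ φ(ζ / t)` make every `t > 0` admissible. -/
theorem kobayashiRoyden_eq_zero_of_entire {D : Set (Cn n)} {φ : ℂ → Cn n}
    (hφ : Differentiable ℂ φ) (hφD : ∀ ζ, φ ζ ∈ D) :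
    kobayashiRoyden D (φ 0) (deriv φ 0) = 0 := by
  have hset : ∀ t : ℝ, 0 < t → kobayashiRoyden D (φ 0) (deriv φ 0) ≤ t := by
    intro t ht
    refine csInf_le ⟨0, fun _ h => h.1.le⟩ ⟨ht, fun ζ => φ ((t : ℂ)⁻¹ * ζ), ?_, fun ζ _ => hφD _,
      by simp, ?_⟩
    · have : Differentiable ℂ fun ζ => φ ((t : ℂ)⁻¹ * ζ) := by fun_prop
      exact this.differentiableOn
    · rw [deriv_comp_mul_left, mul_zero, smul_smul, mul_inv_cancel₀ (by exact_mod_cast ht.ne'),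
        one_smul]
  refine le_antisymm (le_of_forall_pos_le_add fun ε hε => ?_) kobayashiRoyden_nonneg
  simpa using hset ε hε

theorem kobayashiRoyden_smul {D : Set (Cn n)} (haD : a ∈ D) (l : ℂ) (X : Cn n) :
    kobayashiRoyden D a (l • X) = ‖l‖ * kobayashiRoyden D a X := by
  rcases eq_or_ne l 0 with rfl | hl
  · have := kobayashiRoyden_eq_zero_of_entire (D := D) (φ := fun _ => a) (by fun_prop) fun _ => haD
    simpa using this
  -- Rotating the disc by `l / ‖l‖` absorbs the argument of `l`. Applied with `l⁻¹`, it also gives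
  -- the reverse inclusion.
  have key : ∀ {l : ℂ} (X : Cn n) {t : ℝ}, l ≠ 0 → (0 < t ∧ ∃ φ : ℂ → Cn n,
      DifferentiableOn ℂ φ (ball 0 1) ∧ MapsTo φ (ball 0 1) D ∧ φ 0 = a ∧
      (t : ℂ) • deriv φ 0 = X) → (0 < ‖l‖ * t ∧ ∃ φ : ℂ → Cn n,
      DifferentiableOn ℂ φ (ball 0 1) ∧ MapsTo φ (ball 0 1) D ∧ φ 0 = a ∧
      ((‖l‖ * t : ℝ) : ℂ) • deriv φ 0 = l • X) := by
    rintro l X t hl ⟨ht, φ, hφ, hφD, hφ0, hφ1⟩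
    have hl' : (‖l‖ : ℂ) ≠ 0 := by exact_mod_cast norm_ne_zero_iff.2 hl
    have hu : MapsTo (fun ζ : ℂ => l / ‖l‖ * ζ) (ball 0 1) (ball 0 1) := by
      intro ζ hζ
      rw [mem_ball_zero_iff] at hζ ⊢
      rwa [norm_mul, norm_div, Complex.norm_real, norm_norm, div_self (norm_ne_zero_iff.2 hl),
        one_mul]
    refine ⟨mul_pos (norm_pos_iff.2 hl) ht, fun ζ => φ (l / ‖l‖ * ζ), ?_, hφD.comp hu,
      by simpa using hφ0, ?_⟩
    · exact hφ.comp (by fun_prop) hu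
    · rw [deriv_comp_mul_left, mul_zero, smul_smul, ← hφ1, smul_smul]
      congr 1
      push_cast
      field_simp
  rw [kobayashiRoyden, kobayashiRoyden, ← smul_eq_mul, ← Real.sInf_smul_of_nonneg (norm_nonneg l)]
  congr 1
  ext t
  simp only [mem_smul_set, mem_ofPred_eq, smul_eq_mul]
  constructor
  · intro h
    have := key (l • X) (inv_ne_zero hl) h
    rw [inv_smul_smul₀ hl, norm_inv] at this
    exact ⟨_, this, mul_inv_cancel_left₀ (norm_ne_zero_iff.2 hl) t⟩
  · rintro ⟨s, hs, rfl⟩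
    exact key X hl hs

/-- Replacing `φ(μ)` by `(φ_j(μ) exp(μ c_j))` with `∑ α_j c_j = 0` stays in `D` and adds `a_j c_j`
to the velocity at `0`. The same `t` is thus admissible for all vectors with the same value of
`leafForm`. -/
theorem kobayashiRoyden_congr_leafForm (hα : ∀ j, α j ≠ 0) (ha : ∀ j ≠ i, a j ≠ 0)
    {X Y : Cn n} (hXY : leafForm α a i X = leafForm α a i Y) :
    kobayashiRoyden (elemReinhardt α C) a X = kobayashiRoyden (elemReinhardt α C) a Y := by
  have key : ∀ {X Y : Cn n} {t : ℝ}, leafForm α a i X = leafForm α a i Y →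
      (0 < t ∧ ∃ φ : ℂ → Cn n, DifferentiableOn ℂ φ (ball 0 1) ∧
        MapsTo φ (ball 0 1) (elemReinhardt α C) ∧ φ 0 = a ∧ (t : ℂ) • deriv φ 0 = X) →
      (0 < t ∧ ∃ φ : ℂ → Cn n, DifferentiableOn ℂ φ (ball 0 1) ∧
        MapsTo φ (ball 0 1) (elemReinhardt α C) ∧ φ 0 = a ∧ (t : ℂ) • deriv φ 0 = Y) := by
    rintro X Y t hXY ⟨ht, φ, hφ, hφD, hφ0, hφ1⟩
    have ht0 : (t : ℂ) ≠ 0 := by exact_mod_cast ht.ne'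
    have hαi : (α i : ℂ) ≠ 0 := by exact_mod_cast hα i
    set b : Fin n → ℂ := fun j => (Y j - X j) / (t * a j) with hb
    set S := -∑ j ∈ Finset.univ.erase i, (α j / α i : ℂ) * b j with hS
    set c : Fin n → ℂ := fun j => if j = i then S else b j with hc
    have hci : c i = S := if_pos rfl
    have hcj : ∀ j ≠ i, c j = b j := fun j hj => if_neg hj
    have hsum : ∑ j, (α j : ℂ) * c j = 0 := by
      rw [← Finset.add_sum_erase _ _ (Finset.mem_univ i), hci, hS, mul_neg, Finset.mul_sum,
        neg_add_eq_zero]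
      refine Finset.sum_congr rfl fun j hj => ?_
      rw [hcj j (Finset.mem_erase.1 hj).1]
      field_simp
    have hd : DifferentiableOn ℂ (fun μ : ℂ => expScale (μ • c) (φ μ)) (ball 0 1) := by
      refine differentiableOn_euclidean.2 fun j => ?_
      simp only [expScale_apply, Pi.smul_apply, smul_eq_mul]
      have := differentiableOn_euclidean.1 hφ j
      fun_prop
    have h0 : (0 : ℂ) ∈ ball (0 : ℂ) 1 := mem_ball_self one_pos
    refine ⟨ht, fun μ => expScale (μ • c) (φ μ), hd, fun μ hμ => expScale_mem (hφD hμ) ?_, ?_, ?_⟩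
    · simp only [Pi.smul_apply, smul_eq_mul, mul_left_comm _ μ, ← Finset.mul_sum, hsum, mul_zero]
    · ext j; simp [hφ0]
    · have hproj : ∀ {ψ : ℂ → Cn n}, DifferentiableOn ℂ ψ (ball 0 1) → ∀ j,
          HasDerivAt (fun μ => ψ μ j) (deriv ψ 0 j) 0 := fun hψ j =>
        (EuclideanSpace.proj j : Cn n →L[ℂ] ℂ).hasFDerivAt.comp_hasDerivAt 0
          (hψ.differentiableAt (isOpen_ball.mem_nhds h0)).hasDerivAt
      have hval : ∀ j, deriv (fun μ : ℂ => expScale (μ • c) (φ μ)) 0 j =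
          deriv φ 0 j + a j * c j := by
        intro j
        refine (hproj hd j).unique ?_
        have h1 : HasDerivAt (fun μ : ℂ => Complex.exp (μ * c j)) (c j) 0 := by
          simpa using ((hasDerivAt_id (0 : ℂ)).mul_const (c j)).cexp
        have := (hproj hφ j).fun_mul h1
        simpa [hφ0] using this
      have hX : ∀ j, (t : ℂ) * deriv φ 0 j = X j := fun j => by rw [← hφ1]; rfl
      ext j
      rw [PiLp.smul_apply, smul_eq_mul, hval, mul_add, hX]
      -- For `j ≠ i` the choice of `b j` gives `Y j`. The coefficient `c i` is forced by the
      -- constraint, and the `i`-th coordinate comes out right because `leafForm` agrees on `X` and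
      -- `Y`; this covers `a i = 0` as well.
      by_cases hj : j = i
      · subst hj
        rw [leafForm_apply, leafForm_apply] at hXY
        have : ∑ l ∈ Finset.univ.erase j, (α l / α j : ℂ) * b l = (t : ℂ)⁻¹ *
            (∑ l ∈ Finset.univ.erase j, (α l / α j : ℂ) * (Y l / a l) -
              ∑ l ∈ Finset.univ.erase j, (α l / α j : ℂ) * (X l / a l)) := by
          rw [← Finset.sum_sub_distrib, Finset.mul_sum]
          refine Finset.sum_congr rfl fun l hl => ?_
          have := ha l (Finset.mem_erase.1 hl).1
          rw [hb]
          field_simp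
        rw [hci, hS, this]
        generalize (∑ l ∈ Finset.univ.erase j, (α l / α j : ℂ) * (Y l / a l)) = p at *
        generalize (∑ l ∈ Finset.univ.erase j, (α l / α j : ℂ) * (X l / a l)) = q at *
        field_simp
        linear_combination hXY
      · rw [hcj j hj, hb]
        have := ha j hj
        field_simp
        ring
  rw [kobayashiRoyden, kobayashiRoyden]
  congr 1
  ext t
  exact ⟨key hXY, key hXY.symm⟩

theorem kobayashiRoyden_eq (hα : ∀ j, α j ≠ 0) (ha : ∀ j ≠ i, a j ≠ 0)
    (haD : a ∈ elemReinhardt α C) (X : Cn n) :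
    kobayashiRoyden (elemReinhardt α C) a X = ‖leafForm α a i X‖ *
      kobayashiRoyden (elemReinhardt α C) a (EuclideanSpace.single i 1) := by
  rw [← kobayashiRoyden_smul haD]
  refine kobayashiRoyden_congr_leafForm hα ha ?_
  rw [map_smul, leafForm_single, smul_eq_mul, mul_one]

theorem kobayashiRoyden_single_eq_zero (hα : ∀ j, α j ≠ 0) (haD : a ∈ elemReinhardt α C)
    {l : Fin n} (hil : i ≠ l) (hi : a i = 0) :
    kobayashiRoyden (elemReinhardt α C) a (EuclideanSpace.single l 1) = 0 := by
  obtain ⟨g, hg, hg0, hg1, hgD⟩ := exists_entire_curve hα haD hil hi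
  have := kobayashiRoyden_eq_zero_of_entire (by fun_prop) hgD
  have hd : HasDerivAt (fun ζ => a + g ζ • EuclideanSpace.single l (1 : ℂ))
      ((1 : ℂ) • EuclideanSpace.single l (1 : ℂ)) 0 := by
    have := (hg 0).hasDerivAt
    rw [hg1] at this
    exact (this.smul_const _).const_add a
  rwa [hd.deriv, hg0, zero_smul, add_zero, one_smul] at this

end Metrics

end

/-! ### Busemann and Wu pseudometrics governed by one linear form -/

section
open Set

section Sesquilinear
variable {n : ℕ}

/-- The form `(X, Y) ↦ conj (L X) * L Y`. -/
def rankOne (L : Cn n →ₗ[ℂ] ℂ) : SesqForm n :=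
  LinearMap.mk₂'ₛₗ (starRingEnd ℂ) (RingHom.id ℂ) (fun X Y => starRingEnd ℂ (L X) * L Y)
    (fun X X' Y => by simp [add_mul]) (fun c X Y => by simp [mul_assoc])
    (fun X Y Y' => by simp [mul_add]) (fun c X Y => by simp [mul_left_comm])

@[simp] theorem rankOne_apply (L : Cn n →ₗ[ℂ] ℂ) (X Y : Cn n) :
    rankOne L X Y = starRingEnd ℂ (L X) * L Y := rfl

theorem rankOne_apply_self (L : Cn n →ₗ[ℂ] ℂ) (X : Cn n) :
    rankOne L X X = ((‖L X‖ ^ 2 : ℝ) : ℂ) := by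
  rw [rankOne_apply, Complex.conj_mul']
  push_cast; rfl

theorem rankOne_isPosSemidef (L : Cn n →ₗ[ℂ] ℂ) : (rankOne L).IsPosSemidef where
  eq X Y := by simp [mul_comm]
  nonneg X := by
    rw [rankOne_apply_self]
    exact_mod_cast sq_nonneg ‖L X‖

theorem qForm_rankOne (L : Cn n →ₗ[ℂ] ℂ) (X : Cn n) : qForm (rankOne L) X = ‖L X‖ := by
  rw [qForm, rankOne_apply_self, Complex.ofReal_re, Real.sqrt_sq (norm_nonneg _)]

/-- The pre-inner product structure of a positive semidefinite form. -/
abbrev formCore (s : SesqForm n) (hs : s.IsPosSemidef) : PreInnerProductSpace.Core ℂ (Cn n) where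
  inner X Y := s X Y
  conj_inner_symm X Y := hs.eq Y X
  re_inner_nonneg X := (Complex.nonneg_iff.1 (hs.nonneg X)).1
  add_left X Y Z := by simp
  smul_left X Y r := by simp

/-- `q_s` as a seminorm. -/
def qSeminorm (s : SesqForm n) (hs : s.IsPosSemidef) : Seminorm ℂ (Cn n) :=
  letI := InnerProductSpace.Core.toSeminormedAddCommGroup (𝕜 := ℂ) (F := Cn n) (c := formCore s hs)
  letI := InnerProductSpace.Core.toNormedSpace (𝕜 := ℂ) (F := Cn n) (c := formCore s hs)
  normSeminorm ℂ (Cn n)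

theorem qSeminorm_apply (s : SesqForm n) (hs : s.IsPosSemidef) (X : Cn n) :
    qSeminorm s hs X = qForm s X := rfl

theorem norm_apply_le_of_isPosSemidef {s : SesqForm n} (hs : s.IsPosSemidef) (X Y : Cn n) :
    ‖s X Y‖ ≤ qForm s X * qForm s Y := by
  let _ := InnerProductSpace.Core.toSeminormedAddCommGroup (𝕜 := ℂ) (F := Cn n) (c := formCore s hs)
  exact InnerProductSpace.Core.norm_inner_le_norm (𝕜 := ℂ) (F := Cn n) (c := formCore s hs) X Y

end Sesquilinear

section Busemann
variable {n : ℕ} {η : Cn n → Cn n → ℝ} {a : Cn n}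

theorem le_busemann {p : Seminorm ℂ (Cn n)} (hp : ∀ Y, p Y ≤ η a Y) (X : Cn n) :
    p X ≤ busemann η a X :=
  le_csSup ⟨η a X, by rintro _ ⟨q, hq, rfl⟩; exact hq X⟩ ⟨p, hp, rfl⟩

theorem busemann_le (h0 : ∀ Y, 0 ≤ η a Y) (X : Cn n) : busemann η a X ≤ η a X := by
  refine csSup_le ⟨0, 0, h0, rfl⟩ ?_
  rintro _ ⟨p, hp, rfl⟩
  exact hp X

theorem busemann_eq_zero (h : ∀ p : Seminorm ℂ (Cn n), (∀ Y, p Y ≤ η a Y) → ∀ X, p X = 0)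
    (X : Cn n) : busemann η a X = 0 := by
  refine le_antisymm (Real.sSup_nonpos ?_) (Real.sSup_nonneg ?_)
  · rintro _ ⟨p, hp, rfl⟩
    exact (h p hp X).le
  · rintro _ ⟨p, hp, rfl⟩
    exact apply_nonneg p X

/-- A seminorm vanishing on `ker ℓ` depends only on `X` modulo `ker ℓ`, that is, on `ℓ X • e`. -/
theorem busemann_eq_norm_mul {ℓ : Cn n →ₗ[ℂ] ℂ} {e : Cn n} (he : ℓ e = 1)
    (h : ∀ p : Seminorm ℂ (Cn n), (∀ Y, p Y ≤ η a Y) → ∀ X, ℓ X = 0 → p X = 0) (X : Cn n) :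
    busemann η a X = ‖ℓ X‖ * busemann η a e := by
  refine sSup_setOf_eq_mul (norm_nonneg _) fun p hp => ?_
  have h0 : p (X - ℓ X • e) = 0 := h p hp _ (by simp [he])
  refine le_antisymm ?_ ?_
  · have := map_add_le_add p (X - ℓ X • e) (ℓ X • e)
    rwa [sub_add_cancel, h0, zero_add, map_smul_eq_mul] at this
  · have := map_sub_le_add p X (X - ℓ X • e)
    rwa [sub_sub_cancel, h0, add_zero, map_smul_eq_mul] at this

theorem busemann_eq_of_eq_norm_mul {ℓ : Cn n →ₗ[ℂ] ℂ} {c : ℝ} (hc : 0 ≤ c)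
    (h : ∀ X, η a X = ‖ℓ X‖ * c) (X : Cn n) : busemann η a X = η a X := by
  have hp : ∀ Y, (normSeminorm ℂ ℂ).comp ((c : ℂ) • ℓ) Y = η a Y := by
    intro Y
    rw [h Y, mul_comm, Seminorm.comp_apply, coe_normSeminorm, LinearMap.smul_apply, norm_smul,
      Complex.norm_real, Real.norm_of_nonneg hc]
  refine le_antisymm (busemann_le (fun Y => ?_) X) ?_
  · rw [h Y]; positivity
  · rw [← hp X]
    exact le_busemann (fun Y => (hp Y).le) X

/-- If the Busemann pseudometric is the modulus of a linear form, it is the Wu pseudometric. -/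
theorem existsUnique_isWuForm_of_busemann_eq {L : Cn n →ₗ[ℂ] ℂ}
    (hL : ∀ X, busemann η a X = ‖L X‖) (hle : ∀ X, ‖L X‖ ≤ η a X) :
    (∃! s : SesqForm n, IsWuForm η a s) ∧
      ∀ X : Cn n, wu η a X = wuTilde η a X ∧ wuTilde η a X = busemann η a X := by
  have hs₀ : rankOne L ∈ wuF η a :=
    ⟨rankOne_isPosSemidef L, fun X => (qForm_rankOne L X).trans_le (hle X)⟩
  -- `q_t` is a seminorm competing in the definition of the Busemann pseudometric.
  have hq : ∀ t ∈ wuF η a, ∀ X, qForm t X ≤ ‖L X‖ := fun t ht X => by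
    rw [← hL, ← qSeminorm_apply t ht.1]
    exact le_busemann (fun Y => ht.2 Y) X
  have hU : wuU η a = (LinearMap.ker L)ᗮ := by
    have : {X : Cn n | busemann η a X = 0} = (LinearMap.ker L : Set (Cn n)) := by
      ext X
      simp [hL]
    rw [wuU, this, Submodule.span_eq]
  suffices h : IsWuForm η a (rankOne L) ∧ (∀ t, IsWuForm η a t → t = rankOne L) ∧
      ∀ X, Real.sqrt (wuDim η a) * ‖L X‖ = ‖L X‖ by
    obtain ⟨h1, h2, h3⟩ := h
    have hform : wuForm η a = rankOne L := h2 _ (Classical.epsilon_spec ⟨_, h1⟩)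
    refine ⟨⟨_, h1, h2⟩, fun X => ?_⟩
    rw [wu, wuTilde, hform, qForm_rankOne, hL]
    exact ⟨h3 X, rfl⟩
  rcases eq_or_ne L 0 with rfl | hL0
  · have hz : ∀ t ∈ wuF η a, t = rankOne 0 := by
      intro t ht
      refine LinearMap.ext₂ fun X Y => ?_
      have := norm_apply_le_of_isPosSemidef ht.1 X Y
      have hX : qForm t X = 0 := le_antisymm (by simpa using hq t ht X) (Real.sqrt_nonneg _)
      rw [hX, zero_mul] at this
      simpa using this
    refine ⟨⟨hs₀, fun t ht e => ?_⟩, fun t ht => hz t ht.1, by simp⟩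
    rw [hz t ht]
  · have hsurj : Function.Surjective L := LinearMap.surjective hL0
    obtain ⟨e, he⟩ := hsurj 1
    have hdim : wuDim η a = 1 := by
      have h1 := (LinearMap.ker L).finrank_add_finrank_orthogonal
      have h2 := LinearMap.finrank_range_add_finrank_ker L
      rw [LinearMap.range_eq_top.2 hsurj, finrank_top, Module.finrank_self] at h2
      rw [wuDim, hU]
      omega
    -- By Cauchy–Schwarz `ker L` lies in the radical of `t`, so `t` is determined by `t e e`. The
    -- relation `≺` thereby reduces to comparing the numbers `q_t(e)² ≤ 1`, with equality only for
    -- `rankOne L`.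
    have hmul : ∀ t ∈ wuF η a, ∀ X Y, t X Y = (qForm t e ^ 2 : ℝ) * rankOne L X Y := by
      intro t ht X Y
      have hker : ∀ Z, L Z = 0 → qForm t Z = 0 := fun Z hZ =>
        le_antisymm (by simpa [hZ] using hq t ht Z) (Real.sqrt_nonneg _)
      have hl : ∀ Z, L Z = 0 → ∀ W, t Z W = 0 := fun Z hZ W => by
        have := norm_apply_le_of_isPosSemidef ht.1 Z W
        rw [hker Z hZ, zero_mul] at this
        simpa using this
      have hr : ∀ Z, L Z = 0 → ∀ W, t W Z = 0 := fun Z hZ W => by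
        have := norm_apply_le_of_isPosSemidef ht.1 W Z
        rw [hker Z hZ, mul_zero] at this
        simpa using this
      have hee : t e e = (qForm t e ^ 2 : ℝ) := by
        have := Complex.nonneg_iff.1 (ht.1.nonneg e)
        rw [qForm, Real.sq_sqrt this.1]
        exact Complex.ext rfl this.2.symm
      have h1 := hl (X - L X • e) (by simp [he]) Y
      have h2 := hr (Y - L Y • e) (by simp [he]) e
      rw [map_sub, LinearMap.sub_apply, LinearMap.map_smulₛₗ, LinearMap.smul_apply, smul_eq_mul]
        at h1
      rw [map_sub, map_smul, hee, smul_eq_mul] at h2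
      rw [rankOne_apply]
      linear_combination h1 + starRingEnd ℂ (L X) * h2
    have hle1 : ∀ t ∈ wuF η a, qForm t e ^ 2 ≤ 1 := fun t ht => by
      have := hq t ht e
      rw [he, norm_one] at this
      exact pow_le_one₀ (Real.sqrt_nonneg _) this
    have hdet : ∀ t ∈ wuF η a, ∀ b : Module.Basis (Fin (wuDim η a)) ℂ (wuU η a),
        ∃ r > (0 : ℝ), (Matrix.of fun j k => t (b j : Cn n) (b k : Cn n)).det.re =
            qForm t e ^ 2 * r ∧
          (Matrix.of fun j k => rankOne L (b j : Cn n) (b k : Cn n)).det.re = r := by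
      intro t ht b
      let k : Fin (wuDim η a) := ⟨0, by omega⟩
      have hcard : Fintype.card (Fin (wuDim η a)) = 1 := by rw [Fintype.card_fin, hdim]
      -- A vector of `(ker L)ᗮ` that lies in `ker L` is orthogonal to itself, so the `1 × 1` Gram
      -- determinant of `rankOne L` is positive.
      have hbk : L (b k) ≠ 0 := by
        intro h
        have h1 : (b k : Cn n) ∈ (LinearMap.ker L)ᗮ := hU ▸ (b k).2
        have h2 := inner_self_eq_zero.1 (h1 (b k : Cn n) h)
        exact b.ne_zero k (Subtype.ext h2)
      refine ⟨‖L (b k)‖ ^ 2, by positivity, ?_, ?_⟩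
      · rw [Matrix.det_eq_elem_of_card_eq_one hcard k, Matrix.of_apply, hmul t ht,
          rankOne_apply_self, ← Complex.ofReal_mul, Complex.ofReal_re]
      · rw [Matrix.det_eq_elem_of_card_eq_one hcard k, Matrix.of_apply, rankOne_apply_self,
          Complex.ofReal_re]
    refine ⟨⟨hs₀, fun t ht b => ?_⟩, fun t ht => ?_, fun X => by simp [hdim]⟩
    · obtain ⟨r, hr, h1, h2⟩ := hdet t ht b
      rw [h1, h2]
      exact mul_le_of_le_one_left hr.le (hle1 t ht)
    · let b : Module.Basis (Fin (wuDim η a)) ℂ (wuU η a) := Module.finBasis ℂ (wuU η a)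
      obtain ⟨r, hr, h1, h2⟩ := hdet t ht.1 b
      have h3 := ht.2 _ hs₀ b
      rw [h1, h2] at h3
      have h4 : qForm t e ^ 2 = 1 :=
        le_antisymm (hle1 t ht.1) ((le_mul_iff_one_le_left hr).1 h3)
      refine LinearMap.ext₂ fun X Y => ?_
      rw [hmul t ht.1, h4, Complex.ofReal_one, one_mul]

end Busemann

section NumNonzero
variable {n : ℕ} {a : Cn n}

theorem card_zeros_add_numNonzero (a : Cn n) :
    (Finset.univ.filter fun j : Fin n => a j = 0).card + numNonzero a = n := by
  have := Finset.card_filter_add_card_filter_not (s := Finset.univ) (fun j : Fin n => a j = 0)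
  simpa [numNonzero] using this

theorem exists_forall_ne_of_le_numNonzero (hn : 1 ≤ n) (h : n ≤ numNonzero a + 1) :
    ∃ i, ∀ j ≠ i, a j ≠ 0 := by
  have hcard := card_zeros_add_numNonzero a
  -- The index `i` is the only zero coordinate, or the first index when there is none.
  rcases (Finset.univ.filter fun j : Fin n => a j = 0).eq_empty_or_nonempty with h0 | ⟨i, hi⟩
  · refine ⟨⟨0, hn⟩, fun j _ hj => ?_⟩
    have : j ∈ Finset.univ.filter fun j : Fin n => a j = 0 := by simpa using hj
    rw [h0] at this
    simp at this
  · refine ⟨i, fun j hji hj => hji ?_⟩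
    exact Finset.card_le_one.1 (by omega) j (by simpa using hj) i hi

theorem exists_ne_apply_eq_zero_of_numNonzero_lt (h : numNonzero a + 1 < n) (l : Fin n) :
    ∃ i ≠ l, a i = 0 := by
  have hcard := card_zeros_add_numNonzero a
  obtain ⟨i, hi, hil⟩ := Finset.exists_mem_ne
    (s := Finset.univ.filter fun j : Fin n => a j = 0) (by omega) l
  exact ⟨i, hil, by simpa using hi⟩

theorem seminorm_eq_zero_of_single {p : Seminorm ℂ (Cn n)}
    (hp : ∀ l, p (EuclideanSpace.single l 1) = 0) (X : Cn n) : p X = 0 := by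
  have hX : X = ∑ l, X l • EuclideanSpace.single l (1 : ℂ) := by
    ext j
    simp [Pi.single_apply]
  refine le_antisymm ?_ (apply_nonneg p X)
  rw [hX]
  refine (Finset.le_sum_of_subadditive p (map_zero p).le (map_add_le_add p) _ _).trans
    (Finset.sum_nonpos fun l _ => ?_)
  rw [map_smul_eq_mul, hp, mul_zero]

end NumNonzero

end

end WuMetric

end

/-! ### The two assertions, by the number of zero coordinates -/

open WuMetric in
theorem proposition4p2 (n : ℕ) (hn : 1 ≤ n) (α : Fin n → ℝ) (hα : ∀ j, α j ≠ 0) (C : ℝ) :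
    (∀ η : Cn n → Cn n → ℝ, ClassM (elemReinhardt α C) η →
      (∀ z ∈ elemReinhardt α C, ∀ X : Cn n, η z X ≤ kobayashiRoyden (elemReinhardt α C) z X) →
      ∀ a ∈ elemReinhardt α C,
        (∃! s : SesqForm n, IsWuForm η a s) ∧
        ∀ X : Cn n, wu η a X = wuTilde η a X ∧ wuTilde η a X = busemann η a X) ∧
    (∀ η : Cn n → Cn n → ℝ,
      ((∃ k : ℕ, 1 ≤ k ∧ η = caratheodoryReiffen k (elemReinhardt α C)) ∨
        η = azukawa (elemReinhardt α C) ∨ η = kobayashiRoyden (elemReinhardt α C)) →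
      ∀ a ∈ elemReinhardt α C, ∀ X : Cn n,
        (n ≤ numNonzero a + 1 → busemann η a X = η a X) ∧
        (numNonzero a + 1 < n → busemann η a X = 0)) := by
  constructor
  · intro η hη hκ a haD
    have h0 : ∀ Y, 0 ≤ η a Y := fun Y => (hη.1 a haD Y).1
    rcases le_or_gt n (numNonzero a + 1) with h | h
    · obtain ⟨i, hi⟩ := exists_forall_ne_of_le_numNonzero hn h
      -- `η` itself need not depend on `leafForm` alone, but seminorms below `η ≤ κ` vanish on `ker
      -- leafForm`, because `κ` does.
      have hB : ∀ X, busemann η a X =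
          ‖leafForm α a i X‖ * busemann η a (EuclideanSpace.single i 1) := by
        refine busemann_eq_norm_mul leafForm_single fun p hp X hX => ?_
        refine le_antisymm ((hp X).trans ((hκ a haD X).trans_eq ?_)) (apply_nonneg p X)
        rw [kobayashiRoyden_eq hα hi haD, hX, norm_zero, zero_mul]
      have hb : 0 ≤ busemann η a (EuclideanSpace.single i 1) :=
        le_busemann (p := 0) (fun Y => h0 Y) _
      have hL : ∀ X, busemann η a X =
          ‖((busemann η a (EuclideanSpace.single i 1) : ℂ) • leafForm α a i) X‖ := fun X => by
        rw [LinearMap.smul_apply, norm_smul, Complex.norm_real, Real.norm_of_nonneg hb, mul_comm,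
          ← hB]
      exact existsUnique_isWuForm_of_busemann_eq hL fun X => (hL X).symm.trans_le (busemann_le h0 X)
    · refine existsUnique_isWuForm_of_busemann_eq (L := 0) (fun X => ?_) fun X => by simpa using h0 X
      rw [LinearMap.zero_apply, norm_zero]
      refine busemann_eq_zero (fun p hp => seminorm_eq_zero_of_single fun l => ?_) X
      obtain ⟨i, hil, hi⟩ := exists_ne_apply_eq_zero_of_numNonzero_lt h l
      refine le_antisymm ((hp _).trans ((hκ a haD _).trans_eq ?_)) (apply_nonneg p _)
      exact kobayashiRoyden_single_eq_zero hα haD hil hi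
  · intro η hη a haD X
    refine ⟨fun h => ?_, fun h => ?_⟩
    · obtain ⟨i, hi⟩ := exists_forall_ne_of_le_numNonzero hn h
      rcases hη with ⟨k, hk, rfl⟩ | rfl | rfl
      · exact busemann_eq_of_eq_norm_mul caratheodoryReiffen_nonneg
          (caratheodoryReiffen_eq hα hi haD hk) X
      · exact busemann_eq_of_eq_norm_mul (azukawa_nonneg isOpen_elemReinhardt haD)
          (azukawa_eq hα hi haD) X
      · exact busemann_eq_of_eq_norm_mul kobayashiRoyden_nonneg (kobayashiRoyden_eq hα hi haD) X
    · refine busemann_eq_zero (fun p hp => seminorm_eq_zero_of_single fun l => ?_) X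
      obtain ⟨i, hil, hi⟩ := exists_ne_apply_eq_zero_of_numNonzero_lt h l
      refine le_antisymm ((hp _).trans_eq ?_) (apply_nonneg p _)
      rcases hη with ⟨k, hk, rfl⟩ | rfl | rfl
      · exact caratheodoryReiffen_single_eq_zero hα haD hil hi hk
      · exact azukawa_single_eq_zero hα haD hil hi
      · exact kobayashiRoyden_single_eq_zero hα haD hil hi
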